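/- Let $\phi(\cdot;\mu,\sigma^2)$ be the density of the normal distribution with mean $\mu$ and variance $\sigma^2$, let $\phi,\Phi$ be the standard normal density and distribution function, and for a distribution function $G$ put $G^{-1}(p)=\inf\{x: G(x)\ge p\}$. Let $\alpha\in(0,1)$, $\sigma>0$ and $C_R\in\mathbb{R}$. There are constants $c_1,c_2>0$ depending only on $(\alpha,\sigma,C_R)$ such that the following holds. Let $F$ be the reward distribution at a state $s$ (a probability distribution on $\mathbb{R}$ whose distribution function is also denoted by $F$), and let $r_\alpha=F^{-1}(1-\alpha)$. Assume that for some $\mu\in\mathbb{R}$ the distribution $F$ has on $[r_\alpha,\infty)$ the density $\phi(\cdot;\mu,\sigma^2)$, and that $\mathbb{E}_{R\sim F}[R^2]\le C_R$; nothing else is assumed about $F$ below $r_\alpha$. For $N\ge 1$ let $V_N(s)=\mathbb{E}[\max_{1\le i\le N}R^{(i)}]$ with $R^{(1)},\dots,R^{(N)}$ i.i.d. from $F$, and let $E(N)$ be the expected maximum of $N$ i.i.d. standard normal variables. Given i.i.d. samples $r_1,\dots,r_m$ from $F$, let $\hat r_{\alpha/2}$ be their empirical $(1-\alpha/2)$-quantile,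 i.e. $\hat r_{\alpha/2}=\hat F_m^{-1}(1-\alpha/2)$ with $\hat F_m$ the empirical distribution function. Let $\hat\mu_{\rm tail}$ and $\hat\sigma^2_{\rm tail}$ be the mean and the variance (normalized by the number of points) of the samples $r_i\ge\hat r_{\alpha/2}$. With $z=\Phi^{-1}(1-\alpha/2)$, $\lambda(z)=\phi(z)/(1-\Phi(z))$ and $\delta(z)=1+z\lambda(z)-\lambda(z)^2$, put $$\hat\sigma=\sqrt{\hat\sigma^2_{\rm tail}/\delta(z)},\qquad \hat\mu=\hat\mu_{\rm tail}-\hat\sigma\,\lambda(z),\qquad \hat V_N(s)=\hat\mu+\hat\sigma\,E(N).$$ Then for every $N\ge1$, every $\delta\in(0,\tfrac12)$ and every sample size $m\ge c_1\log(1/\delta)$, with probability at least $1-\delta$, $$\bigl|\hat V_N(s)-V_N(s)\bigr|\le c_2\Bigl\{\sqrt{\frac{\log N\cdot\log(1/\delta)}{m}}+\Bigl(1-\frac{\alpha}{2}\Bigr)^{N}\Bigr\}.$$ -/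

import Mathlib

open MeasureTheory ProbabilityTheory

noncomputable section

namespace TailMoM

/-- The quantile function (generalized inverse) of a distribution function `G`. -/
def quantile (G : ℝ → ℝ) (p : ℝ) : ℝ := sInf {x : ℝ | p ≤ G x}

/-- The value function: the expected maximum of `N` independent draws from `F` (for `1 ≤ N`). -/
def value (F : Measure ℝ) (N : ℕ) : ℝ :=
  ∫ x : Fin N → ℝ, (⨆ i, x i) ∂(Measure.pi fun _ => F)

/-- The law with CDF `cdf F` has, on `[r_α, ∞)` with `r_α = F⁻¹(1 - α)`, the Lebesgue density of the
Gaussian with mean `μ` and variance `σ ^ 2`, and its second moment is finite and at most `C`.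
Nothing is required of `F` below `r_α`. -/
structure GaussianTail (F : Measure ℝ) (α μ σ C : ℝ) : Prop where
  tail : F.restrict (Set.Ici (quantile (cdf F) (1 - α))) =
    (volume.restrict (Set.Ici (quantile (cdf F) (1 - α)))).withDensity
      (gaussianPDF μ (σ ^ 2).toNNReal)
  memLp : MemLp id 2 F
  second_moment : ∫ r, r ^ 2 ∂F ≤ C

/-- The inverse Mills ratio `λ(z) = φ(z) / (1 - Φ(z))` of the standard normal distribution. -/
def mills (z : ℝ) : ℝ := gaussianPDFReal 0 1 z / (1 - cdf (gaussianReal 0 1) z)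

/-- `δ(z) = 1 + z λ(z) - λ(z)²`, the variance of a standard normal conditioned on being `≥ z`. -/
def truncVar (z : ℝ) : ℝ := 1 + z * mills z - mills z ^ 2

/-- The empirical distribution function of a sample. -/
def empiricalCDF {m : ℕ} (D : Fin m → ℝ) (x : ℝ) : ℝ :=
  ((Finset.univ.filter fun i => D i ≤ x).card : ℝ) / m

/-- The empirical threshold: the `(1 - α / 2)`-quantile of the sample. -/
def threshold {m : ℕ} (α : ℝ) (D : Fin m → ℝ) : ℝ := quantile (empiricalCDF D) (1 - α / 2)

/-- The indices of the sample points that are at least the empirical threshold. -/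
def tailSet {m : ℕ} (α : ℝ) (D : Fin m → ℝ) : Finset (Fin m) :=
  Finset.univ.filter fun i => threshold α D ≤ D i

/-- Sample mean of the tail. -/
def tailMean {m : ℕ} (α : ℝ) (D : Fin m → ℝ) : ℝ :=
  (∑ i ∈ tailSet α D, D i) / (tailSet α D).card

/-- Sample variance of the tail (normalized by the number of tail points). -/
def tailVar {m : ℕ} (α : ℝ) (D : Fin m → ℝ) : ℝ :=
  (∑ i ∈ tailSet α D, (D i - tailMean α D) ^ 2) / (tailSet α D).card

/-- `z = Φ⁻¹(1 - α / 2)`. -/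
def zq (α : ℝ) : ℝ := quantile (cdf (gaussianReal 0 1)) (1 - α / 2)

/-- The estimate of `σ`. -/
def sigmaHat {m : ℕ} (α : ℝ) (D : Fin m → ℝ) : ℝ := Real.sqrt (tailVar α D / truncVar (zq α))

/-- The estimate of `μ`. -/
def muHat {m : ℕ} (α : ℝ) (D : Fin m → ℝ) : ℝ := tailMean α D - sigmaHat α D * mills (zq α)

/-- The predicted expected maximum for budget `N`: `μ̂ + σ̂ E(N)`, where `E(N)` is the expected
maximum of `N` independent standard normal variables. -/
def valueHat {m : ℕ} (α : ℝ) (N : ℕ) (D : Fin m → ℝ) : ℝ :=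
  muHat α D + sigmaHat α D * value (gaussianReal 0 1) N

end TailMoM

end

/-!
The tail of `F` is exactly Gaussian, so everything the estimator looks at is a statistic of the
truncated standardized variable `W = max ((R - μ) / σ) q`, where `q` is the standard normal
`(1 - α)`-quantile: its law is that of `max Z q` with `Z` standard normal
(`GaussianTail.standardize`), whatever `F` does below `r_α`. Write `z = zq α`,
`ε = √(log (1 / δ) / m)`, and `a₀, a₁, a₂` for the partial moments `E[(Z - z) ^ k; Z > z]`.

*Parameters.* Functions of at most quadratic growth of `W` have empirical means within a multiple of
`ε` of their expectations with high probability (`exists_concentration`, a Chernoff bound from an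
elementary estimate of the moment generating function). Applied to indicators of half-lines with
endpoints at distance `O(ε)` from `z`, this locates the standardized empirical threshold within
`O(ε)` of `z` and estimates the number of tail points. Replacing the random threshold by `z` in the
sums of `(x_i - z) ^ k` over the tail only affects points within `O(ε)` of `z`, each by `O(ε)`, so
these sums are controlled by the empirical means of the fixed functions `(x - z)⁺` and `((x - z)⁺)²`.
The conditional mean and variance are smooth functions of the partial moments, with
`mills z = z + a₁ / a₀` and `truncVar z = a₂ / a₀ - (a₁ / a₀)² > 0`, whence
`|μ̂ - μ|, |σ̂ - σ| = O(ε)` (`exists_parameter_bound`).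

*Value.* The expected maximum of `N` draws from `F` differs from `μ + σ E(N)` only through the event
that all draws fall below `r_α`, which contributes `O((1 - α) ^ (N - 1))`
(`exists_abs_value_sub_le`); the second moment bound enters here, since it bounds `|μ|`. The error
`(σ̂ - σ) E(N)` is `O(ε √(log N))` because `E(N) ≤ √(2 log N)` (`value_gaussian_le`).
-/

namespace TailMoM

open Set Filter Topology

/-! ### Quantiles -/

section Quantile

variable (G : Measure ℝ)

lemma quantile_set_nonempty {p : ℝ} (hp : p < 1) : {x : ℝ | p ≤ cdf G x}.Nonempty := by
  obtain ⟨x, hx⟩ := ((tendsto_cdf_atTop G).eventually (lt_mem_nhds hp)).exists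
  exact ⟨x, hx.le⟩

lemma quantile_set_bddBelow {p : ℝ} (hp : 0 < p) : BddBelow {x : ℝ | p ≤ cdf G x} := by
  obtain ⟨x, hx⟩ := ((tendsto_cdf_atBot G).eventually (gt_mem_nhds hp)).exists
  refine ⟨x, fun y hy => ?_⟩
  by_contra! h
  exact absurd (hy.trans (monotone_cdf G h.le)) (not_le.2 hx)

lemma le_cdf_quantile {p : ℝ} (hp0 : 0 < p) (hp : p < 1) :
    p ≤ cdf G (quantile (cdf G) p) := by
  have hr := (cdf G).right_continuous (quantile (cdf G) p)
  refine ge_of_tendsto (hr.tendsto.mono_left (nhdsWithin_mono _ Ioi_subset_Ici_self)) ?_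
  filter_upwards [self_mem_nhdsWithin] with y hy
  obtain ⟨x, hx, hxy⟩ := (csInf_lt_iff (quantile_set_bddBelow G hp0)
    (quantile_set_nonempty G hp)).1 (mem_Ioi.1 hy)
  exact le_trans hx (monotone_cdf G hxy.le)

lemma cdf_lt_of_lt_quantile {p x : ℝ} (hp0 : 0 < p) (hx : x < quantile (cdf G) p) :
    cdf G x < p := by
  by_contra! h
  exact absurd (csInf_le (quantile_set_bddBelow G hp0) h) (not_le.2 hx)

variable [IsProbabilityMeasure G]

lemma measureReal_Iio_quantile_le {p : ℝ} (hp0 : 0 < p) :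
    G.real (Iio (quantile (cdf G) p)) ≤ p := by
  set r := quantile (cdf G) p
  have h1 : G (Iio r) = ENNReal.ofReal (Function.leftLim (cdf G) r - 0) := by
    conv_lhs => rw [← measure_cdf G]
    exact StieltjesFunction.measure_Iio _ (tendsto_cdf_atBot G) r
  have h2 : Function.leftLim (cdf G) r ≤ p := by
    refine le_of_tendsto ((monotone_cdf G).tendsto_leftLim r) ?_
    filter_upwards [self_mem_nhdsWithin] with y hy
    exact (cdf_lt_of_lt_quantile G hp0 hy).le
  rw [measureReal_def, h1]
  rw [sub_zero]
  exact ENNReal.toReal_le_of_le_ofReal hp0.le (ENNReal.ofReal_le_ofReal h2)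

lemma measureReal_Iio_quantile {p : ℝ} (hp0 : 0 < p) (hp : p < 1)
    (hatom : G {quantile (cdf G) p} = 0) : G.real (Iio (quantile (cdf G) p)) = p := by
  refine le_antisymm (measureReal_Iio_quantile_le G hp0) ?_
  have h := le_cdf_quantile G hp0 hp
  rw [cdf_eq_real] at h
  refine h.trans_eq ?_
  rw [measureReal_def, measureReal_def, measure_congr (Iio_ae_eq_Iic' hatom)]

end Quantile

/-! ### The standard normal distribution -/

lemma measureReal_Iio_gaussian_strictMono :
    StrictMono fun x : ℝ => (gaussianReal 0 1).real (Iio x) := by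
  intro a b hab
  have h : (gaussianReal 0 1).real (Iio b)
      = (gaussianReal 0 1).real (Iio a) + (gaussianReal 0 1).real (Ico a b) := by
    rw [← measureReal_union _ measurableSet_Ico, Iio_union_Ico_eq_Iio hab.le]
    exact disjoint_left.2 fun x hx hx' => absurd hx'.1 (not_le.2 hx)
  have h2 : gaussianReal 0 1 (Ico a b) ≠ 0 := fun h0 => by
    have := gaussianReal_absolutelyContinuous' 0 one_ne_zero h0
    simp at this
    linarith
  have h3 : 0 < (gaussianReal 0 1).real (Ico a b) :=
    ENNReal.toReal_pos h2 (measure_ne_top _ _)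
  simp only [h]
  linarith

lemma measureReal_Iio_gaussian_quantile {p : ℝ} (hp0 : 0 < p) (hp : p < 1) :
    (gaussianReal 0 1).real (Iio (quantile (cdf (gaussianReal 0 1)) p)) = p := by
  have : NullSingletonClass (gaussianReal 0 1) := nullSingletonClass_gaussianReal one_ne_zero
  exact measureReal_Iio_quantile _ hp0 hp (measure_singleton _)

lemma measureReal_Ioi_gaussian (x : ℝ) :
    (gaussianReal 0 1).real (Ioi x) = 1 - (gaussianReal 0 1).real (Iio x) := by
  have : NullSingletonClass (gaussianReal 0 1) := nullSingletonClass_gaussianReal one_ne_zero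
  rw [measureReal_congr (Ioi_ae_eq_Ici (μ := gaussianReal 0 1) (a := x)), ← compl_Iio,
    probReal_compl_eq_one_sub measurableSet_Iio]

lemma measureReal_Ioi_zq {α : ℝ} (hα : α ∈ Ioo (0 : ℝ) 1) :
    (gaussianReal 0 1).real (Ioi (zq α)) = α / 2 := by
  rw [measureReal_Ioi_gaussian, zq, measureReal_Iio_gaussian_quantile] <;> linarith [hα.1, hα.2]

lemma integral_gaussian_eq (f : ℝ → ℝ) :
    ∫ x, f x ∂gaussianReal 0 1 = ∫ x, gaussianPDFReal 0 1 x * f x := by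
  rw [integral_gaussianReal_eq_integral_smul one_ne_zero]; rfl

lemma setIntegral_gaussian_eq (f : ℝ → ℝ) {s : Set ℝ} (hs : MeasurableSet s) :
    ∫ x in s, f x ∂gaussianReal 0 1 = ∫ x in s, gaussianPDFReal 0 1 x * f x := by
  rw [← integral_indicator hs, integral_gaussian_eq, ← integral_indicator hs]
  congr 1 with x
  by_cases h : x ∈ s <;> simp [h]

lemma integrable_gaussian_iff (f : ℝ → ℝ) :
    Integrable f (gaussianReal 0 1) ↔ Integrable (fun x => gaussianPDFReal 0 1 x * f x) := by
  rw [gaussianReal_of_var_ne_zero _ one_ne_zero,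
    integrable_withDensity_iff_integrable_smul' (measurable_gaussianPDF 0 1)
      (ae_of_all _ fun x => gaussianPDF_lt_top)]
  simp [toReal_gaussianPDF]

lemma integrable_pow_gaussian (k : ℕ) : Integrable (fun x : ℝ => x ^ k) (gaussianReal 0 1) := by
  have h := (memLp_id_gaussianReal (μ := 0) (v := 1) (k : NNReal))
  rcases Nat.eq_zero_or_pos k with rfl | hk
  · simp
  · have := MemLp.integrable_norm_pow (p := k) h (by omega)
    refine this.mono' (by fun_prop) (ae_of_all _ fun x => ?_)
    simp

lemma gaussianPDFReal_std (x : ℝ) :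
    gaussianPDFReal 0 1 x = (√(2 * Real.pi))⁻¹ * Real.exp (-x ^ 2 / 2) := by
  simp [gaussianPDFReal]

lemma hasDerivAt_gaussianPDFReal (x : ℝ) :
    HasDerivAt (gaussianPDFReal 0 1) (-(gaussianPDFReal 0 1 x * x)) x := by
  have h : HasDerivAt (fun x : ℝ => (√(2 * Real.pi))⁻¹ * Real.exp (-x ^ 2 / 2))
      ((√(2 * Real.pi))⁻¹ * (Real.exp (-x ^ 2 / 2) * (-(2 * x) / 2))) x := by
    have h1 : HasDerivAt (fun x : ℝ => -x ^ 2 / 2) (-(2 * x) / 2) x := by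
      simpa using ((hasDerivAt_pow 2 x).neg.div_const 2)
    exact (h1.exp).const_mul _
  rw [show gaussianPDFReal 0 1 = _ from funext gaussianPDFReal_std]
  convert h using 1
  ring

lemma gaussianPDFReal_le_one (x : ℝ) : gaussianPDFReal 0 1 x ≤ 1 := by
  rw [gaussianPDFReal_std]
  have h1 : 1 ≤ √(2 * Real.pi) := by
    rw [Real.one_le_sqrt]; linarith [Real.pi_gt_three]
  have h2 : Real.exp (-x ^ 2 / 2) ≤ 1 := by
    rw [Real.exp_le_one_iff]; nlinarith [sq_nonneg x]
  calc _ ≤ 1 * 1 := mul_le_mul (inv_le_one_of_one_le₀ h1) h2 (Real.exp_pos _).le zero_le_one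
    _ = 1 := by norm_num

lemma tendsto_id_mul_gaussianPDFReal :
    Tendsto (fun x => x * gaussianPDFReal 0 1 x) atTop (𝓝 0) := by
  have h : Tendsto (fun x : ℝ => (√(2 * Real.pi))⁻¹ * (x ^ 1 * Real.exp (-x))) atTop
      (𝓝 ((√(2 * Real.pi))⁻¹ * 0)) :=
    (Real.tendsto_pow_mul_exp_neg_atTop_nhds_zero 1).const_mul _
  rw [mul_zero] at h
  refine tendsto_of_tendsto_of_tendsto_of_le_of_le' tendsto_const_nhds h ?_ ?_
  · filter_upwards [eventually_ge_atTop 0] with x hx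
    exact mul_nonneg hx (gaussianPDFReal_nonneg _ _ _)
  · filter_upwards [eventually_ge_atTop 2] with x hx
    rw [gaussianPDFReal_std, pow_one, mul_left_comm]
    gcongr
    nlinarith

lemma tendsto_gaussianPDFReal : Tendsto (gaussianPDFReal 0 1) atTop (𝓝 0) := by
  refine tendsto_of_tendsto_of_tendsto_of_le_of_le' tendsto_const_nhds
    tendsto_id_mul_gaussianPDFReal ?_ ?_
  · exact Eventually.of_forall fun x => gaussianPDFReal_nonneg _ _ _
  · filter_upwards [eventually_ge_atTop 1] with x hx
    exact le_mul_of_one_le_left (gaussianPDFReal_nonneg _ _ _) hx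

lemma setIntegral_Ioi_id_gaussian (z : ℝ) :
    ∫ x in Ioi z, x ∂gaussianReal 0 1 = gaussianPDFReal 0 1 z := by
  rw [setIntegral_gaussian_eq _ measurableSet_Ioi]
  have hd : ∀ x, HasDerivAt (fun x => -gaussianPDFReal 0 1 x) (gaussianPDFReal 0 1 x * x) x :=
    fun x => (hasDerivAt_gaussianPDFReal x).fun_neg.congr_deriv (neg_neg _)
  have hi := (integrable_gaussian_iff _).1 (integrable_pow_gaussian 1)
  simp only [pow_one] at hi
  rw [integral_Ioi_of_hasDerivAt_of_tendsto (hd z).continuousAt.continuousWithinAt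
    (fun x _ => hd x) hi.integrableOn (by simpa using tendsto_gaussianPDFReal.neg)]
  simp

lemma setIntegral_Ioi_sq_gaussian (z : ℝ) :
    ∫ x in Ioi z, x ^ 2 ∂gaussianReal 0 1
      = z * gaussianPDFReal 0 1 z + (gaussianReal 0 1).real (Ioi z) := by
  have hd : ∀ x, HasDerivAt (fun x => -(x * gaussianPDFReal 0 1 x))
      (gaussianPDFReal 0 1 x * (x ^ 2 - 1)) x := fun x => by
    refine (((hasDerivAt_id x).mul (hasDerivAt_gaussianPDFReal x)).neg).congr_deriv ?_
    simp only [id]; ring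
  have hi := (integrable_gaussian_iff _).1 ((integrable_pow_gaussian 2).sub
    (integrable_const (1 : ℝ)))
  have h1 : ∫ x in Ioi z, (x ^ 2 - 1) ∂gaussianReal 0 1 = z * gaussianPDFReal 0 1 z := by
    rw [setIntegral_gaussian_eq _ measurableSet_Ioi,
      integral_Ioi_of_hasDerivAt_of_tendsto (hd z).continuousAt.continuousWithinAt
      (fun x _ => hd x) hi.integrableOn (by simpa using tendsto_id_mul_gaussianPDFReal.neg)]
    simp
  rw [integral_sub (integrable_pow_gaussian 2).integrableOn (integrable_const _).integrableOn] at h1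
  simp at h1
  linarith

lemma integral_posPart_pow_eq (z : ℝ) {k : ℕ} (hk : k ≠ 0) :
    ∫ x, max (x - z) 0 ^ k ∂gaussianReal 0 1 = ∫ x in Ioi z, (x - z) ^ k ∂gaussianReal 0 1 := by
  rw [← integral_indicator measurableSet_Ioi]
  congr 1 with x
  by_cases h : z < x
  · rw [indicator_of_mem (mem_Ioi.2 h), max_eq_left (by linarith)]
  · rw [indicator_of_notMem (by simpa using h), max_eq_right (by linarith), zero_pow hk]

lemma integral_posPart_gaussian (z : ℝ) :
    ∫ x, max (x - z) 0 ∂gaussianReal 0 1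
      = gaussianPDFReal 0 1 z - z * (gaussianReal 0 1).real (Ioi z) := by
  have h := integral_posPart_pow_eq z one_ne_zero
  simp only [pow_one] at h
  have hi := (integrable_pow_gaussian 1)
  simp only [pow_one] at hi
  rw [h, integral_sub hi.integrableOn (integrable_const _).integrableOn,
    setIntegral_Ioi_id_gaussian]
  simp [mul_comm]

lemma integrable_sub_sq_gaussian (c : ℝ) :
    Integrable (fun x : ℝ => (x - c) ^ 2) (gaussianReal 0 1) := by
  have h1 : MemLp (fun x : ℝ => x) 2 (gaussianReal 0 1) := memLp_id_gaussianReal 2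
  exact (h1.sub (memLp_const c)).integrable_sq

lemma setIntegral_Ioi_sub_sq_gaussian (z c : ℝ) :
    ∫ x in Ioi z, (x - c) ^ 2 ∂gaussianReal 0 1
      = z * gaussianPDFReal 0 1 z + (gaussianReal 0 1).real (Ioi z)
        - 2 * c * gaussianPDFReal 0 1 z + c ^ 2 * (gaussianReal 0 1).real (Ioi z) := by
  have hi1 := (integrable_pow_gaussian 1)
  simp only [pow_one] at hi1
  have hi : Integrable (fun x : ℝ => x ^ 2 - 2 * c * x) (gaussianReal 0 1) :=
    (integrable_pow_gaussian 2).sub (hi1.const_mul _)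
  have : ∀ x : ℝ, (x - c) ^ 2 = x ^ 2 - 2 * c * x + c ^ 2 := fun x => by ring
  simp only [this]
  rw [integral_add hi.integrableOn (integrable_const _).integrableOn,
    integral_sub (integrable_pow_gaussian 2).integrableOn (hi1.const_mul _).integrableOn,
    integral_const_mul, setIntegral_Ioi_id_gaussian, setIntegral_Ioi_sq_gaussian]
  simp
  ring

lemma integral_posPart_sq_gaussian (z : ℝ) :
    ∫ x, max (x - z) 0 ^ 2 ∂gaussianReal 0 1
      = (1 + z ^ 2) * (gaussianReal 0 1).real (Ioi z) - z * gaussianPDFReal 0 1 z := by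
  rw [integral_posPart_pow_eq z two_ne_zero, setIntegral_Ioi_sub_sq_gaussian]
  ring

/-- The Gaussian mass of an interval lies between its length times any lower bound for the density
and its length. -/
lemma gaussian_Ioc_bounds {a b c : ℝ} (hab : a ≤ b)
    (hc : ∀ x ∈ Ioc a b, c ≤ gaussianPDFReal 0 1 x) :
    c * (b - a) ≤ (gaussianReal 0 1).real (Ioi a) - (gaussianReal 0 1).real (Ioi b) ∧
    (gaussianReal 0 1).real (Ioi a) - (gaussianReal 0 1).real (Ioi b) ≤ b - a := by
  have h : (gaussianReal 0 1).real (Ioi a)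
      = (gaussianReal 0 1).real (Ioc a b) + (gaussianReal 0 1).real (Ioi b) := by
    rw [← measureReal_union _ measurableSet_Ioi, Ioc_union_Ioi_eq_Ioi hab]
    exact disjoint_left.2 fun x hx hx' => absurd hx.2 (not_le.2 hx')
  have h2 : (gaussianReal 0 1).real (Ioc a b) = ∫ x in Ioc a b, gaussianPDFReal 0 1 x := by
    rw [measureReal_def, gaussianReal_apply_eq_integral _ one_ne_zero, ENNReal.toReal_ofReal]
    exact integral_nonneg fun x => gaussianPDFReal_nonneg _ _ _
  have hi : IntegrableOn (gaussianPDFReal 0 1) (Ioc a b) :=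
    (integrable_gaussianPDFReal 0 1).integrableOn
  have hvol : (volume : Measure ℝ).real (Ioc a b) = b - a := Real.volume_real_Ioc_of_le hab
  rw [h, add_sub_cancel_right, h2]
  constructor
  · have := setIntegral_mono_on (μ := volume) (integrable_const c) hi measurableSet_Ioc hc
    rw [setIntegral_const, hvol, smul_eq_mul] at this
    linarith
  · have := setIntegral_mono_on (μ := volume) hi (integrable_const (1 : ℝ)) measurableSet_Ioc
      (fun x _ => gaussianPDFReal_le_one x)
    rwa [setIntegral_const, hvol, smul_eq_mul, mul_one] at this

lemma exists_gaussianPDFReal_lower (z : ℝ) :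
    ∃ c > 0, ∀ x ∈ Icc (z - 1) (z + 1), c ≤ gaussianPDFReal 0 1 x := by
  refine ⟨gaussianPDFReal 0 1 (|z| + 1), gaussianPDFReal_pos _ _ _ one_ne_zero, fun x hx => ?_⟩
  simp only [gaussianPDFReal_std]
  have h : |x| ≤ |z| + 1 := abs_le.2 ⟨by linarith [hx.1, neg_abs_le z], by
    linarith [hx.2, le_abs_self z]⟩
  have h2 : x ^ 2 ≤ (|z| + 1) ^ 2 := by
    rw [← sq_abs x]; gcongr
  gcongr

/-- `mills z` and `truncVar z` are the mean and the variance of a standard normal variable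
conditioned on exceeding `z`, expressed through the partial moments about `z`. -/
lemma truncVar_eq {α : ℝ} (hα : α ∈ Ioo (0 : ℝ) 1) :
    mills (zq α) = zq α + (∫ x, max (x - zq α) 0 ∂gaussianReal 0 1) / (α / 2) ∧
    truncVar (zq α) = (∫ x, max (x - zq α) 0 ^ 2 ∂gaussianReal 0 1) / (α / 2)
      - ((∫ x, max (x - zq α) 0 ∂gaussianReal 0 1) / (α / 2)) ^ 2 := by
  have hm := measureReal_Ioi_zq hα
  have h1 : 1 - cdf (gaussianReal 0 1) (zq α) = α / 2 := by
    rw [← hm, cdf_eq_real, ← compl_Iic, probReal_compl_eq_one_sub measurableSet_Iic]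
  have h0 : α ≠ 0 := hα.1.ne'
  rw [truncVar, mills, h1, integral_posPart_gaussian, integral_posPart_sq_gaussian, hm]
  constructor
  · field_simp
    ring
  · field_simp
    ring

lemma truncVar_pos {α : ℝ} (hα : α ∈ Ioo (0 : ℝ) 1) : 0 < truncVar (zq α) := by
  have hm := measureReal_Ioi_zq hα
  obtain ⟨-, h⟩ := truncVar_eq hα
  set z := zq α
  set c := (∫ x, max (x - z) 0 ∂gaussianReal 0 1) / (α / 2) with hc
  have hα0 : (0 : ℝ) < α / 2 := by linarith [hα.1]
  have hpos : 0 < ∫ x in Ioi z, (x - (z + c)) ^ 2 ∂gaussianReal 0 1 := by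
    have hi := integrable_sub_sq_gaussian (z + c)
    rw [setIntegral_pos_iff_support_of_nonneg_ae (ae_of_all _ fun x => sq_nonneg _) hi.integrableOn]
    have hsub : Ioi z \ {z + c} ⊆ Function.support (fun x : ℝ => (x - (z + c)) ^ 2) ∩ Ioi z := by
      rintro x ⟨hx, hx'⟩
      refine ⟨?_, hx⟩
      rw [Function.mem_support]
      refine pow_ne_zero _ fun h0 => hx' ?_
      rw [mem_singleton_iff]; linarith
    refine lt_of_lt_of_le ?_ (measure_mono hsub)
    have : NullSingletonClass (gaussianReal 0 1) := nullSingletonClass_gaussianReal one_ne_zero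
    rw [measure_sdiff_null (measure_singleton _)]
    rw [pos_iff_ne_zero]
    intro h0
    rw [measureReal_def, h0] at hm
    simp at hm
    linarith
  have hc' : ∫ x, max (x - z) 0 ∂gaussianReal 0 1 = c * (α / 2) := by
    rw [hc, div_mul_cancel₀ _ hα0.ne']
  rw [h, sub_pos, lt_div_iff₀ hα0, integral_posPart_sq_gaussian, hm]
  rw [setIntegral_Ioi_sub_sq_gaussian, hm] at hpos
  rw [integral_posPart_gaussian, hm] at hc'
  have : gaussianPDFReal 0 1 z = (z + c) * (α / 2) := by linarith
  rw [this] at hpos ⊢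
  linarith

/-! ### Concentration of empirical means of functions of quadratic growth -/

lemma exp_le_one_add_add_sq_mul (x : ℝ) : Real.exp x ≤ 1 + x + x ^ 2 * Real.exp |x| := by
  -- `exp x - 1 ≤ x exp x`, hence `exp x - 1 - x ≤ x (exp x - 1)` and the sign of `x` decides
  have h1 : Real.exp x - 1 ≤ x * Real.exp x := by
    have h := Real.add_one_le_exp (-x)
    have h2 : Real.exp (-x) * Real.exp x = 1 := by rw [← Real.exp_add]; simp
    nlinarith [Real.exp_pos x]
  rcases le_total 0 x with hx | hx
  · rw [abs_of_nonneg hx]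
    nlinarith [Real.add_one_le_exp x]
  · have h3 := Real.add_one_le_exp x
    have h4 : 1 ≤ Real.exp |x| := Real.one_le_exp (abs_nonneg x)
    nlinarith [sq_nonneg x, mul_le_mul_of_nonneg_left h4 (sq_nonneg x)]

lemma sq_le_two_mul_exp_abs (x : ℝ) : x ^ 2 ≤ 2 * Real.exp |x| := by
  have h := Real.quadratic_le_exp_of_nonneg (abs_nonneg x)
  rw [sq_abs] at h
  nlinarith [abs_nonneg x]

section

variable {ν : Measure ℝ} {a B : ℝ}

lemma integrable_sq_of_exp_sq (ha : 0 < a) (hν : Integrable (fun w : ℝ => Real.exp (a * w ^ 2)) ν) :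
    Integrable (fun w : ℝ => w ^ 2) ν := by
  refine (hν.const_mul a⁻¹).mono' (by fun_prop) (ae_of_all _ fun w => ?_)
  have h := Real.add_one_le_exp (a * w ^ 2)
  rw [Real.norm_of_nonneg (sq_nonneg w), ← div_eq_inv_mul, le_div_iff₀ ha]
  linarith

variable [IsProbabilityMeasure ν]

lemma integrable_of_quadratic_growth (hν : Integrable (fun w : ℝ => w ^ 2) ν)
    {f : ℝ → ℝ} (hf : Measurable f) (hfB : ∀ w, |f w| ≤ B * (1 + w ^ 2)) : Integrable f ν :=
  (((integrable_const (1 : ℝ)).add hν).const_mul B).mono' hf.aestronglyMeasurable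
    (ae_of_all _ hfB)

/-- A centered function of at most quadratic growth has a moment generating function of Gaussian
type near `0`, with constants that depend on the growth rate only. -/
lemma exists_mgf_bound (ha : 0 < a) (hB : 0 < B)
    (hν : Integrable (fun w : ℝ => Real.exp (a * w ^ 2)) ν) :
    ∃ s₀ K : ℝ, 0 < s₀ ∧ 0 < K ∧ ∀ f : ℝ → ℝ, Measurable f → (∀ w, |f w| ≤ B * (1 + w ^ 2)) →
      ∀ s, |s| ≤ s₀ → Integrable (fun w => Real.exp (s * (f w - ∫ v, f v ∂ν))) ν ∧
        ∫ w, Real.exp (s * (f w - ∫ v, f v ∂ν)) ∂ν ≤ Real.exp (K * s ^ 2) := by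
  have hsq := integrable_sq_of_exp_sq ha hν
  set M := 1 + ∫ v, v ^ 2 ∂ν with hM
  set s₀ := a / (2 * B) with hs₀
  set D := 2 / s₀ ^ 2 * Real.exp (a * (1 + M)) with hD
  have hs0 : 0 < s₀ := by positivity
  have hI : 0 < ∫ w, Real.exp (a * w ^ 2) ∂ν := integral_exp_pos hν
  refine ⟨s₀, D * ∫ w, Real.exp (a * w ^ 2) ∂ν, hs0, by positivity, fun f hf hfB s hs => ?_⟩
  have hfi := integrable_of_quadratic_growth hsq hf hfB
  set e := ∫ v, f v ∂ν with he
  have hM' : ∫ w, B * (1 + w ^ 2) ∂ν = B * M := by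
    rw [integral_const_mul, integral_add (integrable_const _) hsq]; simp [hM]
  have heM : |e| ≤ B * M := by
    rw [← hM']
    refine abs_integral_le_integral_abs.trans (integral_mono hfi.abs
      (((integrable_const (1 : ℝ)).add hsq).const_mul B) hfB)
  have hY : ∀ w, |f w - e| ≤ B * (1 + M + w ^ 2) := fun w => by
    have := abs_sub (f w) e
    linarith [hfB w]
  have hpt : ∀ w, Real.exp (s * (f w - e))
      ≤ 1 + s * (f w - e) + s ^ 2 * (D * Real.exp (a * w ^ 2)) := by
    intro w
    set y := f w - e
    have h1 := exp_le_one_add_add_sq_mul (s * y)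
    have h2 := sq_le_two_mul_exp_abs (s₀ * y)
    have h3 : |s * y| ≤ s₀ * |y| := by rw [abs_mul]; gcongr
    have h4 : |s₀ * y| = s₀ * |y| := by rw [abs_mul, abs_of_pos hs0]
    have h5 : 2 * (s₀ * |y|) ≤ a * (1 + M) + a * w ^ 2 := by
      calc 2 * (s₀ * |y|) ≤ 2 * (s₀ * (B * (1 + M + w ^ 2))) := by gcongr; exact hY w
        _ = a * (1 + M) + a * w ^ 2 := by rw [hs₀]; field_simp
    have h6 : y ^ 2 * Real.exp |s * y| ≤ D * Real.exp (a * w ^ 2) := by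
      have h7 : y ^ 2 ≤ 2 / s₀ ^ 2 * Real.exp (s₀ * |y|) := by
        rw [h4] at h2
        rw [div_mul_eq_mul_div, le_div_iff₀ (by positivity)]
        nlinarith
      calc y ^ 2 * Real.exp |s * y|
          ≤ 2 / s₀ ^ 2 * Real.exp (s₀ * |y|) * Real.exp (s₀ * |y|) := by gcongr
        _ = 2 / s₀ ^ 2 * Real.exp (2 * (s₀ * |y|)) := by
          rw [mul_assoc, ← Real.exp_add]; ring_nf
        _ ≤ 2 / s₀ ^ 2 * Real.exp (a * (1 + M) + a * w ^ 2) := by gcongr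
        _ = D * Real.exp (a * w ^ 2) := by rw [hD, Real.exp_add]; ring
    calc Real.exp (s * y) ≤ 1 + s * y + s ^ 2 * (y ^ 2 * Real.exp |s * y|) := by
          linarith [h1, mul_pow s y 2, mul_assoc (s ^ 2) (y ^ 2) (Real.exp |s * y|),
            congrArg (· * Real.exp |s * y|) (mul_pow s y 2)]
      _ ≤ _ := by gcongr
  have hint : Integrable (fun w => 1 + s * (f w - e) + s ^ 2 * (D * Real.exp (a * w ^ 2))) ν :=
    ((integrable_const _).add ((hfi.sub (integrable_const _)).const_mul _)).add
      ((hν.const_mul _).const_mul _)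
  have hexp : Integrable (fun w => Real.exp (s * (f w - e))) ν := by
    refine hint.mono' (by fun_prop) (ae_of_all _ fun w => ?_)
    rw [Real.norm_of_nonneg (Real.exp_pos _).le]
    exact hpt w
  refine ⟨hexp, (integral_mono hexp hint hpt).trans ?_⟩
  have hi1 : Integrable (fun w => s * (f w - e)) ν := (hfi.sub (integrable_const _)).const_mul _
  have hi2 : Integrable (fun w => 1 + s * (f w - e)) ν := (integrable_const _).add hi1
  rw [integral_add hi2 ((hν.const_mul _).const_mul _), integral_add (integrable_const _) hi1,
    integral_const_mul, integral_sub hfi (integrable_const _), integral_const_mul,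
    integral_const_mul]
  simp only [integral_const, probReal_univ, smul_eq_mul, one_mul, ← he, sub_self, mul_zero,
    add_zero]
  have := Real.add_one_le_exp (D * (∫ w, Real.exp (a * w ^ 2) ∂ν) * s ^ 2)
  linarith

/-- One-sided Chernoff bound for the sum of independent copies of a centered function. -/
lemma pi_real_sum_ge_le {f : ℝ → ℝ} {s K t : ℝ} (hs : 0 ≤ s)
    (hi : Integrable (fun w => Real.exp (s * f w)) ν)
    (hmgf : ∫ w, Real.exp (s * f w) ∂ν ≤ Real.exp (K * s ^ 2)) (m : ℕ) :
    (Measure.pi fun _ : Fin m => ν).real {x | m * t ≤ ∑ i, f (x i)}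
      ≤ Real.exp (m * (K * s ^ 2 - s * t)) := by
  have hprod : ∀ x : Fin m → ℝ, Real.exp (s * ∑ i, f (x i)) = ∏ i, Real.exp (s * f (x i)) :=
    fun x => by rw [Finset.mul_sum, Real.exp_sum]
  have hI : Integrable (fun x : Fin m → ℝ => Real.exp (s * ∑ i, f (x i)))
      (Measure.pi fun _ : Fin m => ν) := by
    simp only [hprod]
    exact Integrable.fintype_prod (f := fun _ w => Real.exp (s * f w)) fun _ => hi
  refine (measure_ge_le_exp_mul_mgf (m * t) hs hI).trans ?_
  have h1 : mgf (fun x : Fin m → ℝ => ∑ i, f (x i)) (Measure.pi fun _ : Fin m => ν) s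
      = (∫ w, Real.exp (s * f w) ∂ν) ^ m := by
    simp only [mgf, hprod]
    rw [integral_fintype_prod_eq_prod (fun _ w => Real.exp (s * f w))]
    simp
  rw [h1]
  calc _ ≤ Real.exp (-s * (m * t)) * Real.exp (K * s ^ 2) ^ m := by
        gcongr
    _ = _ := by rw [← Real.exp_nat_mul, ← Real.exp_add]; ring_nf

/-- Bernstein-type concentration, uniform over the functions of a given quadratic growth: the
empirical mean is within a multiple of `√(log (1 / δ) / m)` of the expectation. -/
lemma exists_concentration (ha : 0 < a) (hB : 0 < B)
    (hν : Integrable (fun w : ℝ => Real.exp (a * w ^ 2)) ν) :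
    ∃ L η : ℝ, 0 < L ∧ 0 < η ∧ ∀ f : ℝ → ℝ, Measurable f → (∀ w, |f w| ≤ B * (1 + w ^ 2)) →
      ∀ (m : ℕ) (δ : ℝ), 0 < m → δ ∈ Ioo (0 : ℝ) (1 / 2) → √(Real.log (1 / δ) / m) ≤ η →
        (Measure.pi fun _ : Fin m => ν).real
          {x | L * √(Real.log (1 / δ) / m) ≤ |(∑ i, f (x i)) / m - ∫ w, f w ∂ν|} ≤ δ / 5 := by
  obtain ⟨s₀, K, hs₀, hK, h⟩ := exists_mgf_bound ha hB hν
  -- with `t = L ε` and `s = t / (2K)`, the Chernoff exponent is `-m t² / (4K) = -5 log (1 / δ)`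
  set L := √(20 * K) with hL
  have hL0 : 0 < L := by positivity
  refine ⟨L, s₀ * (2 * K) / L, hL0, by positivity, fun f hf hfB m δ hm hδ hε => ?_⟩
  set ε := √(Real.log (1 / δ) / m) with hεd
  have hm' : (0 : ℝ) < m := by exact_mod_cast hm
  have hlog : 0 ≤ Real.log (1 / δ) := by
    apply Real.log_nonneg
    rw [le_div_iff₀ hδ.1]; linarith [hδ.2]
  have hε2 : ε ^ 2 = Real.log (1 / δ) / m := Real.sq_sqrt (by positivity)
  have hL2 : L ^ 2 = 20 * K := Real.sq_sqrt (by positivity)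
  have hε0 : 0 ≤ ε := Real.sqrt_nonneg _
  set s := L * ε / (2 * K) with hs
  have hs0 : 0 ≤ s := by positivity
  have hss : |s| ≤ s₀ := by
    rw [abs_of_nonneg hs0, hs, div_le_iff₀ (by positivity), ← le_div_iff₀' hL0]
    exact hε
  have hexpo : Real.exp (m * (K * s ^ 2 - s * (L * ε))) = δ ^ 5 := by
    have : m * (K * s ^ 2 - s * (L * ε)) = (5 : ℕ) * Real.log δ := by
      have e1 : K * s ^ 2 - s * (L * ε) = -(L ^ 2 * ε ^ 2) / (4 * K) := by
        rw [hs]; field_simp; ring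
      rw [e1, hL2, hε2, Real.log_div one_ne_zero hδ.1.ne', Real.log_one]
      field_simp
      push_cast
      ring
    rw [this, Real.exp_nat_mul, Real.exp_log hδ.1]
  have hone : ∀ g : ℝ → ℝ, Measurable g → (∀ w, |g w| ≤ B * (1 + w ^ 2)) →
      (Measure.pi fun _ : Fin m => ν).real
        {x | m * (L * ε) ≤ ∑ i, (g (x i) - ∫ w, g w ∂ν)} ≤ δ ^ 5 := by
    intro g hg hgB
    obtain ⟨h1, h2⟩ := h g hg hgB s hss
    rw [← hexpo]
    exact pi_real_sum_ge_le hs0 h1 h2 m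
  have h1 := hone f hf hfB
  have h2 := hone (fun w => -f w) hf.neg (fun w => by simpa using hfB w)
  have hsub : {x : Fin m → ℝ | L * ε ≤ |(∑ i, f (x i)) / m - ∫ w, f w ∂ν|} ⊆
      {x | m * (L * ε) ≤ ∑ i, (f (x i) - ∫ w, f w ∂ν)} ∪
      {x | m * (L * ε) ≤ ∑ i, (-f (x i) - ∫ w, -f w ∂ν)} := by
    intro x hx
    have hm2 : m * ((∑ i, f (x i)) / m - ∫ w, f w ∂ν) = (∑ i, f (x i)) - m * ∫ w, f w ∂ν := by
      field_simp
    simp only [mem_union, mem_ofPred_eq, Finset.sum_sub_distrib, Finset.sum_neg_distrib,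
      integral_neg, Finset.sum_const, Finset.card_univ, Fintype.card_fin, nsmul_eq_mul] at hx ⊢
    rcases le_abs.1 hx with hx | hx
    · left
      rw [← hm2]; gcongr
    · right
      have := mul_le_mul_of_nonneg_left hx hm'.le
      linarith
  refine (measureReal_mono hsub).trans ((measureReal_union_le _ _).trans ?_)
  have h3 : δ ^ 4 ≤ (1 / 2) ^ 4 := by gcongr; exacts [hδ.1.le, hδ.2.le]
  nlinarith [hδ.1, mul_le_mul_of_nonneg_left h3 hδ.1.le]

end

/-! ### The expected maximum -/

lemma abs_iSup_le_sum {N : ℕ} (x : Fin N → ℝ) : |⨆ i, x i| ≤ ∑ i, |x i| := by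
  rcases Nat.eq_zero_or_pos N with rfl | hN
  · simp
  · have : Nonempty (Fin N) := ⟨⟨0, hN⟩⟩
    obtain ⟨i, hi⟩ := exists_eq_ciSup_of_finite (f := x)
    rw [← hi]
    exact Finset.single_le_sum (f := fun i => |x i|) (fun i _ => abs_nonneg _) (Finset.mem_univ i)

lemma measurable_iSup_fin (N : ℕ) : Measurable fun x : Fin N → ℝ => ⨆ i, x i :=
  Measurable.iSup fun i => measurable_pi_apply i

section

variable {A B : Measure ℝ} [IsProbabilityMeasure A] [IsProbabilityMeasure B]

lemma integrable_iSup (hA : Integrable id A) (N : ℕ) :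
    Integrable (fun x : Fin N → ℝ => ⨆ i, x i) (Measure.pi fun _ => A) := by
  refine (integrable_finsetSum Finset.univ fun i _ =>
    (integrable_comp_eval (μ := fun _ : Fin N => A) (i := i) hA).abs).mono'
    (measurable_iSup_fin N).aestronglyMeasurable (ae_of_all _ fun x => ?_)
  exact abs_iSup_le_sum x

lemma value_map {f : ℝ → ℝ} (hf : Measurable f) (hmono : Monotone f) (hc : Continuous f)
    {N : ℕ} (hN : 1 ≤ N) :
    value (A.map f) N = ∫ x : Fin N → ℝ, f (⨆ i, x i) ∂Measure.pi fun _ => A := by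
  have : Nonempty (Fin N) := ⟨⟨0, hN⟩⟩
  have : ∀ _ : Fin N, SigmaFinite (A.map f) := fun _ =>
    have := Measure.isProbabilityMeasure_map (μ := A) hf.aemeasurable; inferInstance
  have hmap : Measurable fun (x : Fin N → ℝ) i => f (x i) :=
    measurable_pi_lambda _ fun i => hf.comp (measurable_pi_apply i)
  rw [value, ← Measure.pi_map_pi (fun _ => hf.aemeasurable),
    integral_map hmap.aemeasurable (measurable_iSup_fin N).aestronglyMeasurable]
  congr 1 with x
  exact (hmono.map_ciSup_of_continuousAt hc.continuousAt (finite_range _).bddAbove).symm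

lemma value_map_affine (hA : Integrable id A) (μ : ℝ) {σ : ℝ} (hσ : 0 ≤ σ) {N : ℕ} (hN : 1 ≤ N) :
    value (A.map fun x => μ + σ * x) N = μ + σ * value A N := by
  rw [value_map (by fun_prop) (fun x y h => by gcongr) (by fun_prop) hN,
    integral_add (integrable_const _) ((integrable_iSup hA N).const_mul _), integral_const_mul,
    value]
  simp

/-- The event that all `N` draws fall below `q` carries only an exponentially small part of the
expectation: `(q - max)⁺` is dominated by `(q - x₀)⁺ ∏_{i > 0} 1{x_i < q}`. -/
lemma integral_posPart_sub_iSup_le (hA : Integrable id A) (q : ℝ) {N : ℕ} (hN : 1 ≤ N) :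
    ∫ x : Fin N → ℝ, max (q - ⨆ i, x i) 0 ∂Measure.pi (fun _ => A)
      ≤ A.real (Iio q) ^ (N - 1) * ∫ x, max (q - x) 0 ∂A := by
  obtain ⟨n, rfl⟩ : ∃ n, N = n + 1 := ⟨N - 1, by omega⟩
  let f : Fin (n + 1) → ℝ → ℝ := fun i x => if i = 0 then max (q - x) 0 else
    (Iio q).indicator (fun _ => 1) x
  have hi0 : Integrable (fun x => max (q - x) 0) A := ((integrable_const q).sub hA).pos_part
  have hf : ∀ i, Integrable (f i) A := by
    intro i
    by_cases h : i = 0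
    · simpa [f, h] using hi0
    · simpa [f, h] using (integrable_const (1 : ℝ)).indicator measurableSet_Iio
  have hint : ∫ x : Fin (n + 1) → ℝ, ∏ i, f i (x i) ∂Measure.pi (fun _ => A)
      = A.real (Iio q) ^ (n + 1 - 1) * ∫ x, max (q - x) 0 ∂A := by
    rw [integral_fintype_prod_eq_prod, Fin.prod_univ_succ]
    simp [f, integral_indicator measurableSet_Iio, mul_comm]
  rw [← hint]
  refine integral_mono (((integrable_const q).sub (integrable_iSup hA _)).pos_part)
    (Integrable.fintype_prod hf) fun x => ?_
  have hle : ∀ i, x i ≤ ⨆ i, x i := fun i => le_ciSup (finite_range _).bddAbove i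
  dsimp only
  by_cases h : (⨆ i, x i) < q
  · have : ∀ i : Fin n, f i.succ (x i.succ) = 1 := fun i => by
      simp [f, (hle i.succ).trans_lt h]
    rw [Fin.prod_univ_succ]
    simp only [this, Finset.prod_const_one, mul_one]
    simp only [f, if_true]
    gcongr
    exact hle 0
  · rw [max_eq_right (by linarith)]
    refine Finset.prod_nonneg fun i _ => ?_
    simp only [f]
    split_ifs
    · exact le_max_right _ _
    · exact indicator_nonneg (fun _ _ => zero_le_one) _

/-- Two laws that coincide above `q` have expected maxima that are exponentially close. -/
lemma abs_value_sub_value_le (hA : Integrable id A) (hB : Integrable id B) {q : ℝ}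
    (h : A.map (fun x => max x q) = B.map (fun x => max x q)) {N : ℕ} (hN : 1 ≤ N) :
    |value A N - value B N| ≤ A.real (Iio q) ^ (N - 1) * ∫ x, max (q - x) 0 ∂A
      + B.real (Iio q) ^ (N - 1) * ∫ x, max (q - x) 0 ∂B := by
  have key : ∀ (D : Measure ℝ) [IsProbabilityMeasure D], Integrable id D →
      value D N = value (D.map fun x => max x q) N
        - ∫ x : Fin N → ℝ, max (q - ⨆ i, x i) 0 ∂Measure.pi (fun _ => D) := by
    intro D _ hD
    rw [value_map (by fun_prop) (fun x y h => max_le_max_right q h) (by fun_prop) hN,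
      ← integral_sub, value]
    · congr 1 with x
      rcases le_total (⨆ i, x i) q with h | h
      · rw [max_eq_right h, max_eq_left (by linarith)]; ring
      · rw [max_eq_left h, max_eq_right (by linarith)]; ring
    · exact (integrable_iSup hD N).sup (integrable_const q)
    · exact ((integrable_const q).sub (integrable_iSup hD _)).pos_part
  have h1 := integral_posPart_sub_iSup_le hA q hN
  have h2 := integral_posPart_sub_iSup_le hB q hN
  have h3 : 0 ≤ ∫ x : Fin N → ℝ, max (q - ⨆ i, x i) 0 ∂Measure.pi (fun _ => A) :=
    integral_nonneg fun _ => le_max_right _ _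
  have h4 : 0 ≤ ∫ x : Fin N → ℝ, max (q - ⨆ i, x i) 0 ∂Measure.pi (fun _ => B) :=
    integral_nonneg fun _ => le_max_right _ _
  rw [key A hA, key B hB, h, abs_le]
  constructor <;> linarith

end

lemma integrable_id_gaussian : Integrable id (gaussianReal 0 1) :=
  (memLp_id_gaussianReal 1).integrable (by norm_num)

lemma value_gaussian_nonneg {N : ℕ} (hN : 1 ≤ N) : 0 ≤ value (gaussianReal 0 1) N := by
  have h := integral_comp_eval (μ := fun _ : Fin N => gaussianReal 0 1) (i := ⟨0, hN⟩)
    (f := id) measurable_id.aestronglyMeasurable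
  simp only [id, integral_id_gaussianReal] at h
  refine h.symm.le.trans ?_
  exact integral_mono (integrable_comp_eval (μ := fun _ : Fin N => gaussianReal 0 1)
    integrable_id_gaussian) (integrable_iSup integrable_id_gaussian N)
    fun x => le_ciSup (f := x) (finite_range _).bddAbove _

/-- The expected maximum of `N` standard normal variables is at most `√(2 log N)`. -/
lemma value_gaussian_le {N : ℕ} (hN : 1 ≤ N) :
    value (gaussianReal 0 1) N ≤ √2 * √(Real.log N) := by
  have hN' : (0 : ℝ) < N := by exact_mod_cast hN
  have : Nonempty (Fin N) := ⟨⟨0, hN⟩⟩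
  have key : ∀ s : ℝ, 0 ≤ s → s * value (gaussianReal 0 1) N ≤ Real.log N + s ^ 2 / 2 := by
    intro s hs
    have hpt : ∀ x : Fin N → ℝ, s * (⨆ i, x i) ≤
        Real.log N + s ^ 2 / 2 - 1 + (N * Real.exp (s ^ 2 / 2))⁻¹ * ∑ i, Real.exp (s * x i) := by
      intro x
      obtain ⟨i, hi⟩ := exists_eq_ciSup_of_finite (f := x)
      have h1 := Real.add_one_le_exp (s * x i - (Real.log N + s ^ 2 / 2))
      have h0 : Real.exp (s * x i - (Real.log N + s ^ 2 / 2))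
          = (N * Real.exp (s ^ 2 / 2))⁻¹ * Real.exp (s * x i) := by
        rw [Real.exp_sub, Real.exp_add, Real.exp_log hN', div_eq_inv_mul]
      rw [h0] at h1
      have h2 : Real.exp (s * x i) ≤ ∑ i, Real.exp (s * x i) :=
        Finset.single_le_sum (f := fun i => Real.exp (s * x i)) (fun i _ => (Real.exp_pos _).le)
          (Finset.mem_univ i)
      have h3 := mul_le_mul_of_nonneg_left h2
        (by positivity : 0 ≤ (N * Real.exp (s ^ 2 / 2))⁻¹)
      rw [← hi]
      linarith
    have hie : ∀ i : Fin N, Integrable (fun x : Fin N → ℝ => Real.exp (s * x i))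
        (Measure.pi fun _ => gaussianReal 0 1) := fun i =>
      integrable_comp_eval (μ := fun _ : Fin N => gaussianReal 0 1)
        (f := fun y => Real.exp (s * y)) (integrable_exp_mul_gaussianReal s)
    have hsum : Integrable (fun x : Fin N → ℝ => (N * Real.exp (s ^ 2 / 2))⁻¹ *
        ∑ i, Real.exp (s * x i)) (Measure.pi fun _ => gaussianReal 0 1) :=
      (integrable_finsetSum _ fun i _ => hie i).const_mul _
    have hmgf : ∀ i : Fin N, ∫ x : Fin N → ℝ, Real.exp (s * x i)
        ∂(Measure.pi fun _ => gaussianReal 0 1) = Real.exp (s ^ 2 / 2) := fun i => by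
      rw [integral_comp_eval (μ := fun _ : Fin N => gaussianReal 0 1)
        (f := fun y => Real.exp (s * y)) (by fun_prop)]
      have := congrFun (mgf_id_gaussianReal (μ := 0) (v := 1)) s
      simpa [mgf] using this
    have h := integral_mono ((integrable_iSup integrable_id_gaussian N).const_mul s)
      ((integrable_const (Real.log N + s ^ 2 / 2 - 1)).add hsum) hpt
    rw [integral_const_mul] at h
    refine h.trans_eq ?_
    simp only [Pi.add_apply]
    rw [integral_add (integrable_const _) hsum, integral_const_mul,
      integral_finsetSum _ fun i _ => hie i]
    simp only [hmgf, integral_const, probReal_univ, smul_eq_mul, one_mul, Finset.sum_const,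
      Finset.card_univ, Fintype.card_fin, nsmul_eq_mul]
    rw [inv_mul_cancel₀ (by positivity)]
    ring
  -- the optimal exponent is the expected maximum itself
  have h := key _ (value_gaussian_nonneg hN)
  rw [← Real.sqrt_mul zero_le_two]
  apply Real.le_sqrt_of_sq_le
  nlinarith

/-! ### Consequences of the Gaussian tail -/

lemma map_max_eq_of_restrict_eq {A B : Measure ℝ} [IsProbabilityMeasure A]
    [IsProbabilityMeasure B] {q : ℝ} (h : A.restrict (Ici q) = B.restrict (Ici q)) :
    A.map (fun x => max x q) = B.map (fun x => max x q) := by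
  have hf : Measurable fun x : ℝ => max x q := by fun_prop
  have hIci : A (Ici q) = B (Ici q) := by simpa using congrArg (· univ) h
  have hIio : A (Iio q) = B (Iio q) := by
    rw [← compl_Ici, prob_compl_eq_one_sub measurableSet_Ici,
      prob_compl_eq_one_sub measurableSet_Ici, hIci]
  ext s hs
  rw [Measure.map_apply hf hs, Measure.map_apply hf hs,
    ← measure_inter_add_sdiff _ measurableSet_Ici (μ := A) (t := Ici q),
    ← measure_inter_add_sdiff _ measurableSet_Ici (μ := B) (t := Ici q)]
  congr 1
  · have := congrArg (· ((fun x => max x q) ⁻¹' s)) h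
    simpa [Measure.restrict_apply (hf hs)] using this
  · classical
    have : ((fun x => max x q) ⁻¹' s) \ Ici q = if q ∈ s then Iio q else ∅ := by
      ext x
      by_cases hx : q ≤ x
      · split_ifs <;> simp [hx]
      · have : max x q = q := max_eq_right (not_le.1 hx).le
        split_ifs with hq <;> simp [this, hq, not_le.1 hx]
    rw [this]
    split_ifs
    · exact hIio
    · simp

section Tail

variable {F : Measure ℝ} {α μ σ C : ℝ}

lemma GaussianTail.restrict_eq (hσ : 0 < σ) (h : GaussianTail F α μ σ C) :
    F.restrict (Ici (quantile (cdf F) (1 - α)))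
      = (gaussianReal μ (σ ^ 2).toNNReal).restrict (Ici (quantile (cdf F) (1 - α))) := by
  have hv : (σ ^ 2).toNNReal ≠ 0 := by simpa using hσ.ne'
  rw [h.tail, gaussianReal_of_var_ne_zero _ hv, restrict_withDensity measurableSet_Ici]

variable [IsProbabilityMeasure F]

lemma GaussianTail.measureReal_Iio (hα : α ∈ Ioo (0 : ℝ) 1) (h : GaussianTail F α μ σ C) :
    F.real (Iio (quantile (cdf F) (1 - α))) = 1 - α := by
  refine measureReal_Iio_quantile F (by linarith [hα.2]) (by linarith [hα.1]) ?_
  have h1 := congrArg (· {quantile (cdf F) (1 - α)}) h.tail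
  simp only [Measure.restrict_apply (measurableSet_singleton _)] at h1
  rw [inter_eq_left.2 (by simp)] at h1
  rw [h1]
  exact withDensity_absolutelyContinuous _ _ (measure_mono_null (t := {_}) (fun x hx => hx)
    (Measure.absolutelyContinuous_of_le Measure.restrict_le_self (measure_singleton _)))

lemma gaussianReal_map_standardize (hσ : 0 < σ) :
    (gaussianReal μ (σ ^ 2).toNNReal).map (fun x => (x - μ) / σ) = gaussianReal 0 1 := by
  have h1 : (fun x : ℝ => (x - μ) / σ) = (fun x => x / σ) ∘ (fun x => x - μ) := rfl
  rw [h1, ← Measure.map_map (by fun_prop) (by fun_prop), gaussianReal_map_sub_const,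
    gaussianReal_map_div_const]
  congr 1
  · simp
  · ext
    simp [sq_nonneg, hσ.ne']

/-- After standardization, truncation from below at the standard normal quantile turns `F` into the
truncated standard normal law. -/
lemma GaussianTail.standardize (hα : α ∈ Ioo (0 : ℝ) 1) (hσ : 0 < σ)
    (h : GaussianTail F α μ σ C) :
    (F.map fun x => (x - μ) / σ).real (Iio (quantile (cdf (gaussianReal 0 1)) (1 - α))) = 1 - α ∧
    (F.map fun x => (x - μ) / σ).map (fun x => max x (quantile (cdf (gaussianReal 0 1)) (1 - α)))
      = (gaussianReal 0 1).map (fun x => max x (quantile (cdf (gaussianReal 0 1)) (1 - α))) := by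
  set r := quantile (cdf F) (1 - α) with hr
  set q := (r - μ) / σ with hq
  have hf : Measurable fun x : ℝ => (x - μ) / σ := by fun_prop
  have hpre : (fun x : ℝ => (x - μ) / σ) ⁻¹' Ici q = Ici r := by
    ext x
    simp [hq, div_le_div_iff_of_pos_right hσ]
  have hpre' : (fun x : ℝ => (x - μ) / σ) ⁻¹' Iio q = Iio r := by
    ext x
    simp [hq, div_lt_div_iff_of_pos_right hσ]
  have : IsProbabilityMeasure (F.map fun x => (x - μ) / σ) :=
    Measure.isProbabilityMeasure_map hf.aemeasurable
  have hres : (F.map fun x => (x - μ) / σ).restrict (Ici q)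
      = (gaussianReal 0 1).restrict (Ici q) := by
    rw [← gaussianReal_map_standardize (μ := μ) hσ, Measure.restrict_map hf measurableSet_Ici,
      Measure.restrict_map hf measurableSet_Ici, hpre, h.restrict_eq hσ]
  have hF : (F.map fun x => (x - μ) / σ).real (Iio q) = 1 - α := by
    rw [map_measureReal_apply hf measurableSet_Iio, hpre', h.measureReal_Iio hα]
  have hG : (gaussianReal 0 1).real (Iio q) = 1 - α := by
    rw [← hF, ← compl_Ici, probReal_compl_eq_one_sub measurableSet_Ici,
      probReal_compl_eq_one_sub measurableSet_Ici]
    have := congrArg (fun M => M.real univ) hres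
    simp only [measureReal_restrict_apply_univ] at this
    rw [this]
  have hqq : quantile (cdf (gaussianReal 0 1)) (1 - α) = q := by
    apply measureReal_Iio_gaussian_strictMono.injective
    dsimp only
    rw [hG, measureReal_Iio_gaussian_quantile (by linarith [hα.2]) (by linarith [hα.1])]
  rw [hqq]
  exact ⟨hF, map_max_eq_of_restrict_eq hres⟩

/-- The second moment bound controls the location of the Gaussian tail, because the tail has
mass `α`. -/
lemma GaussianTail.sq_le (hα : α ∈ Ioo (0 : ℝ) 1) (hσ : 0 < σ) (h : GaussianTail F α μ σ C) :
    μ ^ 2 ≤ (2 * C + 2 * σ ^ 2) / α := by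
  set r := quantile (cdf F) (1 - α) with hr
  have hres := h.restrict_eq hσ
  rw [← hr] at hres
  have hmass : F.real (Ici r) = α := by
    rw [← compl_Iio, probReal_compl_eq_one_sub measurableSet_Iio, h.measureReal_Iio hα]
    ring
  have hi2 : Integrable (fun x : ℝ => x ^ 2) F := h.memLp.integrable_sq
  have hG2 : MemLp (fun x : ℝ => x - μ) 2 (gaussianReal μ (σ ^ 2).toNNReal) :=
    (memLp_id_gaussianReal 2).sub (memLp_const μ)
  have hF2 : MemLp (fun x : ℝ => x - μ) 2 F := h.memLp.sub (memLp_const μ)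
  have h1 : ∫ x in Ici r, x ^ 2 ∂F ≤ C :=
    (setIntegral_le_integral hi2 (ae_of_all _ fun x => sq_nonneg x)).trans h.second_moment
  have h2 : ∫ x in Ici r, (x - μ) ^ 2 ∂F ≤ σ ^ 2 := by
    rw [hres]
    refine (setIntegral_le_integral hG2.integrable_sq (ae_of_all _ fun x => sq_nonneg _)).trans ?_
    have hv := variance_id_gaussianReal (μ := μ) (v := (σ ^ 2).toNNReal)
    rw [variance_eq_integral measurable_id.aemeasurable] at hv
    simp only [id, integral_id_gaussianReal] at hv
    rw [hv, Real.coe_toNNReal _ (sq_nonneg σ)]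
  have h3 : ∫ x in Ici r, μ ^ 2 ∂F ≤ ∫ x in Ici r, (2 * x ^ 2 + 2 * (x - μ) ^ 2) ∂F := by
    refine integral_mono (integrable_const _) ((hi2.integrableOn.const_mul 2).add
      (hF2.integrable_sq.integrableOn.const_mul 2)) fun x => ?_
    dsimp only
    nlinarith [sq_nonneg (x + (x - μ))]
  rw [integral_add (hi2.integrableOn.const_mul 2) (hF2.integrable_sq.integrableOn.const_mul 2),
    integral_const_mul, integral_const_mul, setIntegral_const, hmass, smul_eq_mul] at h3
  rw [le_div_iff₀ hα.1]
  linarith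

end Tail

/-- The value function is that of the normal distribution with the parameters of the tail, up to
an exponentially small error. -/
lemma exists_abs_value_sub_le {α σ C : ℝ} (hα : α ∈ Ioo (0 : ℝ) 1) (hσ : 0 < σ) :
    ∃ K : ℝ, ∀ (F : Measure ℝ) [IsProbabilityMeasure F] (μ : ℝ),
      GaussianTail F α μ σ C → ∀ N : ℕ, 1 ≤ N →
        |μ + σ * value (gaussianReal 0 1) N - value F N| ≤ K * (1 - α / 2) ^ N := by
  set q := quantile (cdf (gaussianReal 0 1)) (1 - α) with hq
  set I := ∫ x, max (q - x) 0 ∂gaussianReal 0 1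
  set J := |q| + ((1 + C) / 2 + √((2 * C + 2 * σ ^ 2) / α)) / σ
  refine ⟨σ * (J + I) / (1 - α / 2), fun F _ μ h N hN => ?_⟩
  obtain ⟨hmass, hmap⟩ := h.standardize hα hσ
  rw [← hq] at hmass hmap
  have hf : Measurable fun x : ℝ => (x - μ) / σ := by fun_prop
  set F' := F.map fun x => (x - μ) / σ with hF'
  have : IsProbabilityMeasure F' := Measure.isProbabilityMeasure_map hf.aemeasurable
  have hid : Integrable id F := h.memLp.integrable (by norm_num)
  have hidx : Integrable (fun x : ℝ => (x - μ) / σ) F :=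
    (hid.sub (integrable_const μ)).div_const σ
  have hid' : Integrable id F' :=
    (integrable_map_measure (by fun_prop) hf.aemeasurable).2 hidx
  have hback : F = F'.map fun x => μ + σ * x := by
    rw [hF', Measure.map_map (by fun_prop) hf]
    have : (fun x => μ + σ * x) ∘ (fun x : ℝ => (x - μ) / σ) = id := by
      ext x; simp only [Function.comp, id]; field_simp; ring
    rw [this, Measure.map_id]
  have hval : value F N = μ + σ * value F' N := by
    conv_lhs => rw [hback]
    exact value_map_affine hid' μ hσ.le hN
  have hmassG : (gaussianReal 0 1).real (Iio q) = 1 - α :=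
    measureReal_Iio_gaussian_quantile (by linarith [hα.2]) (by linarith [hα.1])
  have hcomp := abs_value_sub_value_le hid' integrable_id_gaussian hmap hN
  rw [hmass, hmassG] at hcomp
  have hJ : ∫ x, max (q - x) 0 ∂F' ≤ J := by
    rw [hF', integral_map hf.aemeasurable (by fun_prop)]
    have hi2 : Integrable (fun x : ℝ => x ^ 2) F := h.memLp.integrable_sq
    have hμ : |μ| ≤ √((2 * C + 2 * σ ^ 2) / α) := Real.abs_le_sqrt (h.sq_le hα hσ)
    have hdom : Integrable (fun x : ℝ => |q| + ((1 + x ^ 2) / 2 + |μ|) / σ) F :=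
      (integrable_const _).add (((((integrable_const _).add hi2).div_const 2).add
        (integrable_const _)).div_const σ)
    refine (integral_mono (((integrable_const q).sub hidx).pos_part) hdom fun x => ?_).trans ?_
    · have h1 : |x| ≤ (1 + x ^ 2) / 2 := by
        rw [← sq_abs]; nlinarith [sq_nonneg (|x| - 1)]
      have h2 : (x - μ) / σ ≥ - (((1 + x ^ 2) / 2 + |μ|) / σ) := by
        rw [ge_iff_le, ← neg_div]
        gcongr
        linarith [neg_abs_le x, le_abs_self μ]
      apply max_le
      · simp only [Pi.sub_apply]
        linarith [le_abs_self q]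
      · positivity
    · have e1 : Integrable (fun x : ℝ => (1 + x ^ 2) / 2) F :=
        ((integrable_const _).add hi2).div_const 2
      have e2 : Integrable (fun x : ℝ => ((1 + x ^ 2) / 2 + |μ|) / σ) F :=
        (e1.add (integrable_const _)).div_const σ
      rw [integral_add (integrable_const _) e2, integral_div,
        integral_add e1 (integrable_const _), integral_div,
        integral_add (integrable_const _) hi2]
      simp only [integral_const, probReal_univ, smul_eq_mul, one_mul]
      simp only [J]
      gcongr
      exact h.second_moment
  have hI0 : 0 ≤ I := integral_nonneg fun _ => le_max_right _ _
  have hJ0 : 0 ≤ J := le_trans (integral_nonneg fun _ => le_max_right _ _) hJ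
  have hα2 : 0 < 1 - α / 2 := by linarith [hα.2]
  have hpow : (1 - α) ^ (N - 1) ≤ (1 - α / 2) ^ N / (1 - α / 2) := by
    obtain ⟨n, rfl⟩ : ∃ n, N = n + 1 := ⟨N - 1, by omega⟩
    rw [pow_succ (1 - α / 2), mul_div_cancel_right₀ _ hα2.ne', Nat.add_sub_cancel]
    exact pow_le_pow_left₀ (by linarith [hα.2]) (by linarith [hα.1]) n
  have hp0 : 0 ≤ (1 - α) ^ (N - 1) := pow_nonneg (by linarith [hα.2]) _
  rw [hval, show μ + σ * value (gaussianReal 0 1) N - (μ + σ * value F' N)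
    = -(σ * (value F' N - value (gaussianReal 0 1) N)) by ring, abs_neg, abs_mul, abs_of_pos hσ]
  calc σ * |value F' N - value (gaussianReal 0 1) N|
      ≤ σ * ((1 - α) ^ (N - 1) * J + (1 - α) ^ (N - 1) * I) := by
        gcongr
        exact hcomp.trans (by gcongr)
    _ = σ * (J + I) * (1 - α) ^ (N - 1) := by ring
    _ ≤ σ * (J + I) * ((1 - α / 2) ^ N / (1 - α / 2)) := by gcongr
    _ = _ := by ring

/-! ### Error of the estimator on a good sample -/

section

variable {m : ℕ}

lemma empiricalCDF_mono (D : Fin m → ℝ) : Monotone (empiricalCDF D) := by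
  intro x y hxy
  simp only [empiricalCDF]
  gcongr

lemma empiricalCDF_eq (hm : 0 < m) (D : Fin m → ℝ) (c : ℝ) :
    empiricalCDF D c = 1 - (∑ i, (Ioi c).indicator (fun _ => (1 : ℝ)) (D i)) / m := by
  have hm' : (m : ℝ) ≠ 0 := by positivity
  have h : ∀ i, (Ioi c).indicator (fun _ => (1 : ℝ)) (D i) = if D i ≤ c then 0 else 1 := by
    intro i
    by_cases h : D i ≤ c
    · simp [h]
    · simp [h, not_le.1 h]
  have h2 : ∀ i, (if D i ≤ c then (0 : ℝ) else 1) = 1 - if D i ≤ c then 1 else 0 := by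
    intro i; split_ifs <;> simp
  simp only [empiricalCDF, h, h2, Finset.sum_sub_distrib, Finset.sum_boole]
  simp
  field_simp
  ring

lemma threshold_mem_Icc {α a b : ℝ} {D : Fin m → ℝ} (ha : empiricalCDF D a < 1 - α / 2)
    (hb : 1 - α / 2 ≤ empiricalCDF D b) : threshold α D ∈ Icc a b := by
  have hlow : ∀ y ∈ {x : ℝ | 1 - α / 2 ≤ empiricalCDF D x}, a ≤ y := fun y hy => by
    by_contra! h
    exact absurd (le_trans hy (empiricalCDF_mono D h.le)) (not_le.2 ha)
  exact ⟨le_csInf ⟨b, hb⟩ hlow, csInf_le ⟨a, hlow⟩ hb⟩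

/-- Moving the threshold by at most `η` away from `z` changes a partial moment about `z` by at most
`η ^ k`, since only terms with `|x - z| ≤ η` are affected. -/
lemma abs_tail_pow_sub_le {τ z η x : ℝ} (hτ : τ ∈ Icc (z - η) (z + η)) {k : ℕ} (hk : k ≠ 0) :
    |(if τ ≤ x then (x - z) ^ k else 0) - max (x - z) 0 ^ k| ≤ η ^ k := by
  have hη : 0 ≤ η := by linarith [hτ.1, hτ.2]
  have hclose : |x - z| ≤ η → |(x - z) ^ k| ≤ η ^ k := fun h => by
    rw [abs_pow]; gcongr
  rcases le_total z x with hz | hz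
  · rw [max_eq_left (by linarith)]
    split_ifs with h
    · simpa using pow_nonneg hη k
    · rw [zero_sub, abs_neg]
      exact hclose (abs_le.2 ⟨by linarith, by linarith [hτ.2]⟩)
  · rw [max_eq_right (by linarith), zero_pow hk, sub_zero]
    split_ifs with h
    · exact hclose (abs_le.2 ⟨by linarith [hτ.1], by linarith⟩)
    · simpa using pow_nonneg hη k

lemma abs_mean_tail_pow_sub_le (hm : 0 < m) {τ z η : ℝ} (x : Fin m → ℝ)
    (hτ : τ ∈ Icc (z - η) (z + η)) {k : ℕ} (hk : k ≠ 0) :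
    |(∑ i with τ ≤ x i, (x i - z) ^ k) / m - (∑ i, max (x i - z) 0 ^ k) / m| ≤ η ^ k := by
  have hm' : (0 : ℝ) < m := by exact_mod_cast hm
  rw [Finset.sum_filter, ← sub_div, ← Finset.sum_sub_distrib, abs_div, abs_of_pos hm',
    div_le_iff₀ hm']
  refine (Finset.abs_sum_le_sum_abs _ _).trans
    ((Finset.sum_le_sum fun i _ => abs_tail_pow_sub_le hτ hk).trans_eq ?_)
  simp [mul_comm]

end

lemma exists_abs_ratio_sub_le {a₀ : ℝ} (ha₀ : 0 < a₀) (a₁ : ℝ) :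
    ∃ κ > 0, ∀ A₀ A₁ ρ : ℝ, |A₀ - a₀| ≤ ρ → |A₁ - a₁| ≤ ρ → ρ ≤ a₀ / 2 →
      |A₁ / A₀ - a₁ / a₀| ≤ κ * ρ := by
  refine ⟨2 * (a₀ + |a₁|) / a₀ ^ 2, by positivity, fun A₀ A₁ ρ h0 h1 hρ => ?_⟩
  have hA : a₀ / 2 ≤ A₀ := by linarith [(abs_le.1 h0).1]
  have hA0 : 0 < A₀ := by linarith
  have hρ0 : 0 ≤ ρ := (abs_nonneg _).trans h0
  have e : A₁ / A₀ - a₁ / a₀ = ((A₁ - a₁) * a₀ - a₁ * (A₀ - a₀)) / (A₀ * a₀) := by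
    field_simp; ring
  have hnum : |(A₁ - a₁) * a₀ - a₁ * (A₀ - a₀)| ≤ ρ * (a₀ + |a₁|) := by
    refine (abs_sub _ _).trans ?_
    rw [abs_mul, abs_mul, abs_of_pos ha₀]
    nlinarith [mul_le_mul_of_nonneg_right h1 ha₀.le,
      mul_le_mul_of_nonneg_left h0 (abs_nonneg a₁)]
  rw [e, abs_div, abs_of_pos (mul_pos hA0 ha₀)]
  calc _ ≤ ρ * (a₀ + |a₁|) / (a₀ / 2 * a₀) := by gcongr
    _ = _ := by field_simp

/-- The conditional mean and variance are locally Lipschitz functions of the partial moments. -/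
lemma exists_moment_ratio_bound {a₀ : ℝ} (ha₀ : 0 < a₀) (a₁ a₂ : ℝ) :
    ∃ κ > 0, ∀ A₀ A₁ A₂ ρ : ℝ, |A₀ - a₀| ≤ ρ → |A₁ - a₁| ≤ ρ → |A₂ - a₂| ≤ ρ → ρ ≤ a₀ / 2 →
      |A₁ / A₀ - a₁ / a₀| ≤ κ * ρ ∧
      |(A₂ / A₀ - (A₁ / A₀) ^ 2) - (a₂ / a₀ - (a₁ / a₀) ^ 2)| ≤ κ * ρ := by
  obtain ⟨κ₁, hκ₁, h₁⟩ := exists_abs_ratio_sub_le ha₀ a₁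
  obtain ⟨κ₂, hκ₂, h₂⟩ := exists_abs_ratio_sub_le ha₀ a₂
  refine ⟨κ₁ + κ₂ + κ₁ * (κ₁ * (a₀ / 2) + 2 * |a₁ / a₀|), by positivity,
    fun A₀ A₁ A₂ ρ h0 h1 h2 hρ => ?_⟩
  have hρ0 : 0 ≤ ρ := (abs_nonneg _).trans h0
  have e1 := h₁ A₀ A₁ ρ h0 h1 hρ
  have e2 := h₂ A₀ A₂ ρ h0 h2 hρ
  set u := A₁ / A₀
  set v := a₁ / a₀
  have e3 : |u ^ 2 - v ^ 2| ≤ κ₁ * (κ₁ * (a₀ / 2) + 2 * |v|) * ρ := by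
    have e4 : |u + v| ≤ κ₁ * (a₀ / 2) + 2 * |v| := by
      have h5 := abs_add_le (u - v) (2 * v)
      rw [show u - v + 2 * v = u + v by ring, abs_mul, abs_two] at h5
      have := mul_le_mul_of_nonneg_left hρ hκ₁.le
      linarith
    rw [show u ^ 2 - v ^ 2 = (u - v) * (u + v) by ring, abs_mul]
    calc _ ≤ κ₁ * ρ * (κ₁ * (a₀ / 2) + 2 * |v|) := by gcongr
      _ = _ := by ring
  have hq : 0 ≤ κ₁ * (κ₁ * (a₀ / 2) + 2 * |v|) * ρ := (abs_nonneg _).trans e3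
  have hκ₁ρ : 0 ≤ κ₁ * ρ := by positivity
  have hκ₂ρ : 0 ≤ κ₂ * ρ := by positivity
  constructor
  · linarith
  · rw [show (A₂ / A₀ - u ^ 2) - (a₂ / a₀ - v ^ 2)
      = (A₂ / A₀ - a₂ / a₀) - (u ^ 2 - v ^ 2) by ring]
    refine (abs_sub _ _).trans ?_
    linarith

lemma abs_sqrt_sub_le {v σ : ℝ} (hv : 0 ≤ v) (hσ : 0 < σ) : |√v - σ| ≤ |v - σ ^ 2| / σ := by
  rw [le_div_iff₀ hσ]
  calc |√v - σ| * σ ≤ |√v - σ| * (√v + σ) := by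
        gcongr; linarith [Real.sqrt_nonneg v]
    _ = |v - σ ^ 2| := by
      rw [← abs_of_nonneg (by positivity : 0 ≤ √v + σ), ← abs_mul]
      congr 1
      nlinarith [Real.sq_sqrt hv]

/-- The tail statistics of the sample `μ + σ x` in terms of the partial moments
`(1 / m) ∑_{τ ≤ x_i} (x_i - z) ^ k` of the standardized sample. -/
lemma tailMean_tailVar_eq {m : ℕ} {α μ σ τ : ℝ} (hm : 0 < m) (x : Fin m → ℝ)
    (hτ : tailSet α (fun i => μ + σ * x i) = Finset.univ.filter fun i => τ ≤ x i)
    (z : ℝ) {A₀ A₁ A₂ : ℝ} (hA₀ : A₀ = ((Finset.univ.filter fun i => τ ≤ x i).card : ℝ) / m)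
    (hA₁ : A₁ = (∑ i with τ ≤ x i, (x i - z) ^ 1) / m)
    (hA₂ : A₂ = (∑ i with τ ≤ x i, (x i - z) ^ 2) / m) (hpos : 0 < A₀) :
    tailMean α (fun i => μ + σ * x i) = μ + σ * (z + A₁ / A₀) ∧
    tailVar α (fun i => μ + σ * x i) = σ ^ 2 * (A₂ / A₀ - (A₁ / A₀) ^ 2) := by
  have hm' : (0 : ℝ) < m := by exact_mod_cast hm
  set k := ((Finset.univ.filter fun i => τ ≤ x i).card : ℝ) with hk
  have hcard : 0 < k := by
    rw [hA₀] at hpos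
    exact (div_pos_iff_of_pos_right hm').1 hpos
  have r1 : A₁ / A₀ = (∑ i with τ ≤ x i, (x i - z)) / k := by
    rw [hA₀, hA₁]; simp only [pow_one]; rw [div_div_div_cancel_right₀ hm'.ne']
  have r2 : A₂ / A₀ = (∑ i with τ ≤ x i, (x i - z) ^ 2) / k := by
    rw [hA₀, hA₂, div_div_div_cancel_right₀ hm'.ne']
  have hmean : tailMean α (fun i => μ + σ * x i) = μ + σ * (z + A₁ / A₀) := by
    have r1' : ∑ i with τ ≤ x i, x i = (z + A₁ / A₀) * k := by
      rw [Finset.sum_sub_distrib, Finset.sum_const, nsmul_eq_mul, eq_div_iff hcard.ne'] at r1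
      linarith
    rw [tailMean, hτ, Finset.sum_add_distrib, ← Finset.mul_sum, r1', Finset.sum_const,
      nsmul_eq_mul, div_eq_iff hcard.ne']
    ring
  refine ⟨hmean, ?_⟩
  rw [tailVar, hmean, hτ, r2]
  set u := A₁ / A₀
  have e : ∀ i, (μ + σ * x i - (μ + σ * (z + u))) ^ 2
      = σ ^ 2 * (x i - z) ^ 2 - 2 * σ ^ 2 * u * (x i - z) + σ ^ 2 * u ^ 2 := fun i => by ring
  have r1' : ∑ i with τ ≤ x i, (x i - z)
      = u * k := by
    rw [r1, div_mul_cancel₀ _ hcard.ne']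
  simp only [e]
  rw [Finset.sum_add_distrib, Finset.sum_sub_distrib, ← Finset.mul_sum, ← Finset.mul_sum, r1',
    Finset.sum_const, nsmul_eq_mul, ← hk, div_eq_iff hcard.ne', mul_assoc (σ ^ 2), sub_mul,
    div_mul_cancel₀ _ hcard.ne']
  ring

/-- If the empirical tail probabilities near `z` and the empirical partial moments about `z` are
within `ρ` of their expectations, the estimates of `μ` and `σ` are within a multiple of `ρ`. -/
lemma exists_estimator_error {α σ : ℝ} (hα : α ∈ Ioo (0 : ℝ) 1) (hσ : 0 < σ) :
    ∃ κ > 0, ∀ (m : ℕ), 0 < m → ∀ (x : Fin m → ℝ) (μ η ρ : ℝ), 0 < η → η ≤ 1 → ρ ≤ α / 2 / 2 →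
      α / 2 < (∑ i, (Ioi (zq α - η)).indicator (fun _ => (1 : ℝ)) (x i)) / m →
      (∑ i, (Ioi (zq α + η)).indicator (fun _ => (1 : ℝ)) (x i)) / m ≤ α / 2 →
      (∑ i, (Ioi (zq α - 2 * η)).indicator (fun _ => (1 : ℝ)) (x i)) / m ≤ α / 2 + ρ →
      α / 2 - ρ ≤ (∑ i, (Ioi (zq α + η)).indicator (fun _ => (1 : ℝ)) (x i)) / m →
      |(∑ i, max (x i - zq α) 0) / m - ∫ w, max (w - zq α) 0 ∂gaussianReal 0 1| + η ≤ ρ →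
      |(∑ i, max (x i - zq α) 0 ^ 2) / m - ∫ w, max (w - zq α) 0 ^ 2 ∂gaussianReal 0 1| + η ≤ ρ →
      |muHat α (fun i => μ + σ * x i) - μ| ≤ κ * ρ ∧
      |sigmaHat α (fun i => μ + σ * x i) - σ| ≤ κ * ρ := by
  obtain ⟨hmills, htv⟩ := truncVar_eq hα
  have htv0 := truncVar_pos hα
  have hα2 : 0 < α / 2 := by linarith [hα.1]
  set z := zq α with hz
  set a₁ := ∫ w, max (w - z) 0 ∂gaussianReal 0 1
  set a₂ := ∫ w, max (w - z) 0 ^ 2 ∂gaussianReal 0 1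
  obtain ⟨κ, hκ, hratio⟩ := exists_moment_ratio_bound hα2 a₁ a₂
  refine ⟨σ * κ + σ * κ / truncVar z * (1 + |mills z|), by positivity,
    fun m hm x μ η ρ hη hη1 hρ hlow hup h0u h0l h1 h2 => ?_⟩
  have hm' : (0 : ℝ) < m := by exact_mod_cast hm
  set D : Fin m → ℝ := fun i => μ + σ * x i with hD
  have hind : ∀ c, ∑ i, (Ioi (μ + σ * c)).indicator (fun _ => (1 : ℝ)) (D i)
      = ∑ i, (Ioi c).indicator (fun _ => (1 : ℝ)) (x i) := fun c => by
    refine Finset.sum_congr rfl fun i _ => ?_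
    simp only [indicator_apply, mem_Ioi, hD, add_lt_add_iff_left, mul_lt_mul_iff_right₀ hσ]
  have hth : threshold α D ∈ Icc (μ + σ * (z - η)) (μ + σ * (z + η)) := by
    apply threshold_mem_Icc
    · rw [empiricalCDF_eq hm, hind]; linarith
    · rw [empiricalCDF_eq hm, hind]; linarith
  set τ := (threshold α D - μ) / σ with hτd
  have hτ : τ ∈ Icc (z - η) (z + η) := by
    rw [hτd]
    constructor
    · rw [le_div_iff₀ hσ]; linarith [hth.1]
    · rw [div_le_iff₀ hσ]; linarith [hth.2]
  have htail : tailSet α D = Finset.univ.filter fun i => τ ≤ x i := by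
    ext i
    simp only [tailSet, Finset.mem_filter, Finset.mem_univ, true_and, hτd, div_le_iff₀ hσ, hD]
    constructor <;> intro h <;> linarith
  set A₀ := ((Finset.univ.filter fun i => τ ≤ x i).card : ℝ) / m with hA₀
  set A₁ := (∑ i with τ ≤ x i, (x i - z) ^ 1) / m with hA₁
  set A₂ := (∑ i with τ ≤ x i, (x i - z) ^ 2) / m with hA₂
  have hA₀' : A₀ = (∑ i, if τ ≤ x i then (1 : ℝ) else 0) / m := by
    rw [hA₀, Finset.sum_boole]
  have e0 : |A₀ - α / 2| ≤ ρ := by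
    rw [abs_le]
    constructor
    · have : (∑ i, (Ioi (z + η)).indicator (fun _ => (1 : ℝ)) (x i)) / m ≤ A₀ := by
        rw [hA₀']
        gcongr with i
        simp only [indicator_apply, mem_Ioi]
        split_ifs with h h' h'
        · exact le_rfl
        · exact absurd (hτ.2.trans h.le) h'
        · exact zero_le_one
        · exact le_rfl
      linarith
    · have : A₀ ≤ (∑ i, (Ioi (z - 2 * η)).indicator (fun _ => (1 : ℝ)) (x i)) / m := by
        rw [hA₀']
        gcongr with i
        simp only [indicator_apply, mem_Ioi]
        split_ifs with h h' h'
        · exact le_rfl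
        · exact absurd (by linarith [hτ.1] : z - 2 * η < x i) h'
        · exact zero_le_one
        · exact le_rfl
      linarith
  have e1 : |A₁ - a₁| ≤ ρ := by
    have := abs_mean_tail_pow_sub_le hm x hτ one_ne_zero
    simp only [pow_one] at this hA₁
    rw [← hA₁] at this
    linarith [abs_sub_le A₁ ((∑ i, max (x i - z) 0) / m) a₁]
  have e2 : |A₂ - a₂| ≤ ρ := by
    have := abs_mean_tail_pow_sub_le hm x hτ two_ne_zero
    rw [← hA₂] at this
    have hsq : η ^ 2 ≤ η := by nlinarith
    linarith [abs_sub_le A₂ ((∑ i, max (x i - z) 0 ^ 2) / m) a₂]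
  have hA0 : 0 < A₀ := by linarith [(abs_le.1 e0).1]
  obtain ⟨hmean, hvar⟩ := tailMean_tailVar_eq hm x htail z hA₀ hA₁ hA₂ hA0
  obtain ⟨g1, g2⟩ := hratio A₀ A₁ A₂ ρ e0 e1 e2 hρ
  have hρ0 : 0 ≤ ρ := (abs_nonneg _).trans e0
  have hs : |sigmaHat α D - σ| ≤ σ * κ / truncVar z * ρ := by
    have hv : 0 ≤ tailVar α D / truncVar z := by
      refine div_nonneg (div_nonneg (Finset.sum_nonneg fun i _ => sq_nonneg _) ?_) htv0.le
      positivity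
    refine (abs_sqrt_sub_le hv hσ).trans ?_
    have e : tailVar α D / truncVar z - σ ^ 2
        = σ ^ 2 / truncVar z * ((A₂ / A₀ - (A₁ / A₀) ^ 2) - truncVar z) := by
      rw [hvar, mul_sub (σ ^ 2 / truncVar z), div_mul_cancel₀ _ htv0.ne', div_mul_eq_mul_div]
    rw [← htv] at g2
    have hc : 0 < σ ^ 2 / truncVar z := by positivity
    rw [e, abs_mul, abs_of_pos hc, div_le_iff₀ hσ]
    refine (mul_le_mul_of_nonneg_left g2 hc.le).trans_eq ?_
    ring
  have hμ : muHat α D - μ = σ * (A₁ / A₀ - a₁ / (α / 2)) - (sigmaHat α D - σ) * mills z := by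
    rw [muHat, hmean, ← hz, hmills]; ring
  have hq : 0 ≤ σ * κ / truncVar z * ρ := (abs_nonneg _).trans hs
  have hκρ : (σ * κ + σ * κ / truncVar z * (1 + |mills z|)) * ρ
      = σ * (κ * ρ) + (σ * κ / truncVar z * ρ + σ * κ / truncVar z * ρ * |mills z|) := by ring
  have i1 := mul_le_mul_of_nonneg_right hs (abs_nonneg (mills z))
  have i2 : 0 ≤ σ * κ / truncVar z * ρ * |mills z| := mul_nonneg hq (abs_nonneg _)
  have i3 : 0 ≤ σ * (κ * ρ) := by positivity
  rw [hκρ]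
  constructor
  · rw [hμ]
    refine (abs_sub _ _).trans ?_
    rw [abs_mul, abs_mul, abs_of_pos hσ]
    have i4 := mul_le_mul_of_nonneg_left g1 hσ.le
    linarith
  · linarith

/-! ### High-probability bounds -/

lemma integrable_exp_sq_gaussian : Integrable (fun x => Real.exp (1 / 4 * x ^ 2))
    (gaussianReal 0 1) := by
  rw [integrable_gaussian_iff]
  refine ((integrable_exp_neg_mul_sq (b := 1 / 4) (by norm_num)).const_mul
    (√(2 * Real.pi))⁻¹).congr (ae_of_all _ fun x => ?_)
  dsimp only
  rw [gaussianPDFReal_std, mul_assoc, ← Real.exp_add]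
  ring_nf

lemma integrable_exp_sq_map_max (q : ℝ) : Integrable (fun x => Real.exp (1 / 4 * x ^ 2))
    ((gaussianReal 0 1).map fun x => max x q) := by
  rw [integrable_map_measure (by fun_prop) (by fun_prop)]
  refine (integrable_exp_sq_gaussian.mul_const (Real.exp (1 / 4 * q ^ 2))).mono' (by fun_prop)
    (ae_of_all _ fun x => ?_)
  rw [Function.comp, Real.norm_of_nonneg (Real.exp_pos _).le, ← Real.exp_add]
  apply Real.exp_le_exp.2
  rcases max_choice x q with h | h <;> rw [h] <;> nlinarith [sq_nonneg x, sq_nonneg q]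

lemma real_map_sample_eq {F : Measure ℝ} {Ω : Type*} [MeasurableSpace Ω] {P : Measure Ω}
    [IsProbabilityMeasure P] {m : ℕ} {R : Fin m → Ω → ℝ} (hind : iIndepFun R P)
    (hlaw : ∀ i, HasLaw (R i) F P) {g : ℝ → ℝ} (hg : Measurable g) {s : Set (Fin m → ℝ)}
    (hs : MeasurableSet s) :
    P.real {ω | (fun i => g (R i ω)) ∈ s} = (Measure.pi fun _ : Fin m => F.map g).real s := by
  have hae : ∀ i, AEMeasurable (fun ω => g (R i ω)) P := fun i =>
    hg.comp_aemeasurable (hlaw i).aemeasurable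
  have hind' : iIndepFun (fun i ω => g (R i ω)) P := hind.comp (fun _ => g) fun _ => hg
  have h := (iIndepFun_iff_map_fun_eq_pi_map hae).1 hind'
  have hmap : ∀ i, P.map (fun ω => g (R i ω)) = F.map g := fun i => by
    rw [← (hlaw i).map_eq, AEMeasurable.map_map_of_aemeasurable hg.aemeasurable
      (hlaw i).aemeasurable]
    rfl
  simp only [hmap] at h
  rw [← h, measureReal_def, measureReal_def,
    Measure.map_apply_of_aemeasurable (aemeasurable_pi_lambda _ hae) hs]
  rfl

lemma one_sub_le_real_of_compl_subset {Ω : Type*} [MeasurableSpace Ω] {P : Measure Ω}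
    [IsProbabilityMeasure P] {δ : ℝ} {S₁ S₂ S₃ S₄ S₅ G : Set Ω} (h₁ : P.real S₁ ≤ δ / 5)
    (h₂ : P.real S₂ ≤ δ / 5) (h₃ : P.real S₃ ≤ δ / 5) (h₄ : P.real S₄ ≤ δ / 5)
    (h₅ : P.real S₅ ≤ δ / 5)
    (hG : ∀ ω, ω ∉ S₁ → ω ∉ S₂ → ω ∉ S₃ → ω ∉ S₄ → ω ∉ S₅ → ω ∈ G) : 1 - δ ≤ P.real G := by
  have hcover : (univ : Set Ω) ⊆ G ∪ (S₁ ∪ (S₂ ∪ (S₃ ∪ (S₄ ∪ S₅)))) := by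
    intro ω _
    by_contra hω
    simp only [mem_union, not_or] at hω
    exact hω.1 (hG ω hω.2.1 hω.2.2.1 hω.2.2.2.1 hω.2.2.2.2.1 hω.2.2.2.2.2)
  have h := measureReal_mono (μ := P) hcover
  rw [probReal_univ] at h
  linarith [measureReal_union_le (μ := P) G (S₁ ∪ (S₂ ∪ (S₃ ∪ (S₄ ∪ S₅)))),
    measureReal_union_le (μ := P) S₁ (S₂ ∪ (S₃ ∪ (S₄ ∪ S₅))),
    measureReal_union_le (μ := P) S₂ (S₃ ∪ (S₄ ∪ S₅)), measureReal_union_le (μ := P) S₃ (S₄ ∪ S₅),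
    measureReal_union_le (μ := P) S₄ S₅]

/-- The parameter estimates have the parametric rate. -/
lemma exists_parameter_bound {α σ : ℝ} (hα : α ∈ Ioo (0 : ℝ) 1) (hσ : 0 < σ) (C : ℝ) :
    ∃ ε₀ κ : ℝ, 0 < ε₀ ∧ 0 < κ ∧
      ∀ (F : Measure ℝ) [IsProbabilityMeasure F] (μ : ℝ), GaussianTail F α μ σ C →
      ∀ (δ : ℝ), δ ∈ Ioo (0 : ℝ) (1 / 2) →
      ∀ (m : ℕ), 0 < m → √(Real.log (1 / δ) / m) ≤ ε₀ →
      ∀ {Ω : Type*} [MeasurableSpace Ω] (P : Measure Ω) [IsProbabilityMeasure P]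
        (R : Fin m → Ω → ℝ), iIndepFun R P → (∀ i, HasLaw (R i) F P) →
        1 - δ ≤ P.real {ω |
          |muHat α (fun i => R i ω) - μ| ≤ κ * √(Real.log (1 / δ) / m) ∧
          |sigmaHat α (fun i => R i ω) - σ| ≤ κ * √(Real.log (1 / δ) / m)} := by
  set q := quantile (cdf (gaussianReal 0 1)) (1 - α) with hq
  obtain ⟨κ, hκ, hest⟩ := exists_estimator_error hα hσ
  have hmz := measureReal_Ioi_zq hα
  have hqz : q < zq α := by
    apply measureReal_Iio_gaussian_strictMono.lt_iff_lt.1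
    rw [hq, zq, measureReal_Iio_gaussian_quantile (by linarith [hα.2]) (by linarith [hα.1]),
      measureReal_Iio_gaussian_quantile (by linarith [hα.2]) (by linarith [hα.1])]
    linarith [hα.1]
  set z := zq α with hz
  set ν := (gaussianReal 0 1).map fun x => max x q with hν
  have hmax : Measurable fun x : ℝ => max x q := by fun_prop
  have : IsProbabilityMeasure ν := Measure.isProbabilityMeasure_map hmax.aemeasurable
  have hB : 0 < 2 * (1 + z ^ 2) := by positivity
  obtain ⟨L, ε₁, hL, hε₁, hconc⟩ :=
    exists_concentration (by norm_num : (0 : ℝ) < 1 / 4) hB (integrable_exp_sq_map_max q)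
  obtain ⟨c, hc, hdens⟩ := exists_gaussianPDFReal_lower z
  -- moving the threshold by `k ε` changes the tail mass by at least `2 L ε`, which beats the
  -- fluctuation `L ε` of the empirical tail mass
  set k := 2 * L / c with hk
  have hk0 : 0 < k := by positivity
  have hα0 := hα.1
  refine ⟨min (min ε₁ (1 / k)) (min ((z - q) / (2 * k)) (α / 2 / 2 / (L + 2 * k))),
    κ * (L + 2 * k), ?_, by positivity, fun F _ μ h δ hδ m hm hε Ω _ P _ R hind hlaw => ?_⟩
  · have : 0 < z - q := by linarith
    positivity
  set ε := √(Real.log (1 / δ) / m) with hεd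
  have hε1 : ε ≤ ε₁ := hε.trans ((min_le_left _ _).trans (min_le_left _ _))
  have hε2 : k * ε ≤ 1 := by
    rw [← le_div_iff₀' hk0]
    exact hε.trans ((min_le_left _ _).trans (min_le_right _ _))
  have hε3 : 2 * (k * ε) ≤ z - q := by
    rw [← mul_assoc, ← le_div_iff₀' (by positivity)]
    exact hε.trans ((min_le_right _ _).trans (min_le_left _ _))
  have hε4 : (L + 2 * k) * ε ≤ α / 2 / 2 := by
    rw [← le_div_iff₀' (by positivity)]
    exact hε.trans ((min_le_right _ _).trans (min_le_right _ _))
  have hm' : (0 : ℝ) < m := by exact_mod_cast hm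
  have hε0 : 0 < ε := by
    refine Real.sqrt_pos.2 (div_pos (Real.log_pos ?_) hm')
    rw [lt_div_iff₀ hδ.1]; linarith [hδ.2]
  set η := k * ε with hη
  have hη0 : 0 < η := by positivity
  have hcη : c * η = 2 * L * ε := by rw [hη, hk]; field_simp
  obtain ⟨-, hmap⟩ := h.standardize hα hσ
  rw [← hq] at hmap
  set g : ℝ → ℝ := fun x => max ((x - μ) / σ) q with hg
  have hgm : Measurable g := by fun_prop
  have hFg : F.map g = ν := by
    rw [hν, ← hmap, Measure.map_map hmax (by fun_prop)]
    rfl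
  -- each of the five statistics deviates with probability at most `δ / 5`
  have hdev : ∀ f : ℝ → ℝ, Measurable f → (∀ w, |f w| ≤ 2 * (1 + z ^ 2) * (1 + w ^ 2)) →
      (∀ w, f (max w q) = f w) →
      P.real {ω | L * ε ≤ |(∑ i, f ((R i ω - μ) / σ)) / m - ∫ w, f w ∂gaussianReal 0 1|}
        ≤ δ / 5 := by
    intro f hf hfB hfq
    have h1 := hconc f hf hfB m δ hm hδ hε1
    rw [← hν, ← hFg, ← real_map_sample_eq hind hlaw hgm
      (measurableSet_le measurable_const (by fun_prop)),
      hFg, hν, integral_map hmax.aemeasurable hf.aestronglyMeasurable] at h1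
    simpa only [hfq, hg, hFg, mem_ofPred_eq] using h1
  have hindic : ∀ c, q ≤ c → P.real {ω | L * ε ≤
      |(∑ i, (Ioi c).indicator (fun _ => (1 : ℝ)) ((R i ω - μ) / σ)) / m
        - (gaussianReal 0 1).real (Ioi c)|} ≤ δ / 5 := by
    intro c hc
    have h1 := hdev ((Ioi c).indicator fun _ => (1 : ℝ))
      (measurable_const.indicator measurableSet_Ioi) (fun w => ?_) (fun w => ?_)
    · rwa [integral_indicator measurableSet_Ioi, setIntegral_const, smul_eq_mul, mul_one] at h1
    · have : |(Ioi c).indicator (fun _ => (1 : ℝ)) w| ≤ 1 := by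
        rw [indicator_apply]; split_ifs <;> simp
      nlinarith [sq_nonneg z, sq_nonneg w, mul_nonneg (sq_nonneg z) (sq_nonneg w)]
    · simp only [indicator_apply, mem_Ioi, lt_max_iff, not_lt.2 hc, or_false]
  have hposq : ∀ w, max (max w q - z) 0 = max (w - z) 0 := fun w => by
    rcases le_total w q with hw | hw
    · rw [max_eq_right hw, max_eq_right (by linarith), max_eq_right (by linarith)]
    · rw [max_eq_left hw]
  have hpossq : ∀ w, max (w - z) 0 ^ 2 ≤ 2 * (w ^ 2 + z ^ 2) := fun w => by
    rcases le_total w z with hw | hw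
    · rw [max_eq_right (by linarith)]; nlinarith [sq_nonneg w, sq_nonneg z]
    · rw [max_eq_left (by linarith)]; nlinarith [sq_nonneg (w + z)]
  have b1 := hindic (z - η) (by linarith)
  have b2 := hindic (z + η) (by linarith)
  have b3 := hindic (z - 2 * η) (by linarith)
  have b4 := hdev (fun w => max (w - z) 0) (by fun_prop) (fun w => by
    rw [abs_of_nonneg (le_max_right (w - z) 0)]
    have h0 : 0 ≤ max (w - z) 0 := le_max_right _ _
    nlinarith [hpossq w, sq_nonneg (max (w - z) 0 - 1), mul_nonneg (sq_nonneg z) (sq_nonneg w)])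
    hposq
  have b5 := hdev (fun w => max (w - z) 0 ^ 2) (by fun_prop) (fun w => by
    rw [abs_of_nonneg (sq_nonneg _)]
    nlinarith [hpossq w, mul_nonneg (sq_nonneg z) (sq_nonneg w)]) (fun w => by rw [hposq])
  obtain ⟨d1, d1'⟩ := gaussian_Ioc_bounds (a := z - η) (b := z) (c := c) (by linarith)
    (fun x hx => hdens x ⟨by linarith [hx.1], by linarith [hx.2]⟩)
  obtain ⟨d2, d2'⟩ := gaussian_Ioc_bounds (a := z) (b := z + η) (c := c) (by linarith)
    (fun x hx => hdens x ⟨by linarith [hx.1], by linarith [hx.2]⟩)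
  obtain ⟨-, d3'⟩ := gaussian_Ioc_bounds (a := z - 2 * η) (b := z) (c := 0) (by linarith)
    (fun x _ => gaussianPDFReal_nonneg _ _ _)
  rw [hmz] at d1 d1' d2 d2' d3'
  refine one_sub_le_real_of_compl_subset b1 b2 b3 b4 b5 fun ω n1 n2 n3 n4 n5 => ?_
  rw [mem_ofPred_eq, not_le, abs_lt] at n1 n2 n3
  rw [mem_ofPred_eq, not_le] at n4 n5
  have hx : (fun i => R i ω) = fun i => μ + σ * ((R i ω - μ) / σ) := by
    ext i; field_simp; ring
  have hρ : (L + 2 * k) * ε = L * ε + 2 * η := by rw [hη]; ring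
  rw [mem_ofPred_eq, mul_assoc, hx]
  refine hest m hm (fun i => (R i ω - μ) / σ) μ η ((L + 2 * k) * ε) hη0 hε2 hε4 ?_ ?_ ?_ ?_ ?_ ?_
    <;> linarith

end TailMoM

theorem theorem1 (α σ C : ℝ) (hα : α ∈ Set.Ioo (0 : ℝ) 1) (hσ : 0 < σ) :
    ∃ c₁ c₂ : ℝ, 0 < c₁ ∧ 0 < c₂ ∧
      ∀ (F : Measure ℝ) [IsProbabilityMeasure F] (μ : ℝ), TailMoM.GaussianTail F α μ σ C →
      ∀ (N : ℕ), 1 ≤ N → ∀ (δ : ℝ), δ ∈ Set.Ioo (0 : ℝ) (1 / 2) →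
      ∀ (m : ℕ), c₁ * Real.log (1 / δ) ≤ (m : ℝ) →
      ∀ {Ω : Type*} [MeasurableSpace Ω] (P : Measure Ω) [IsProbabilityMeasure P]
        (R : Fin m → Ω → ℝ), iIndepFun R P → (∀ i, HasLaw (R i) F P) →
        1 - δ ≤ P.real {ω |
          |TailMoM.valueHat α N (fun i => R i ω) - TailMoM.value F N| ≤
            c₂ * (Real.sqrt (Real.log N * Real.log (1 / δ) / m) + (1 - α / 2) ^ N)} := by
  obtain ⟨K, hK⟩ := TailMoM.exists_abs_value_sub_le (C := C) hα hσ
  obtain ⟨ε₀, κ, hε₀, hκ, hpar⟩ := TailMoM.exists_parameter_bound hα hσ C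
  have hβ : 0 < 1 - α / 2 := by linarith [hα.2]
  have hlog2 : 0 < Real.log 2 := Real.log_pos one_lt_two
  refine ⟨1 / ε₀ ^ 2, κ / √(Real.log 2) + κ * √2 + κ * ε₀ / (1 - α / 2) + |K|,
    by positivity, by positivity, fun F _ μ h N hN δ hδ m hm Ω _ P _ R hind hlaw => ?_⟩
  have hlogδ : 0 < Real.log (1 / δ) := by
    apply Real.log_pos
    rw [lt_div_iff₀ hδ.1]; linarith [hδ.2]
  have hm' : (0 : ℝ) < m := lt_of_lt_of_le (by positivity) hm
  have hε : √(Real.log (1 / δ) / m) ≤ ε₀ := by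
    rw [Real.sqrt_le_iff]
    refine ⟨hε₀.le, ?_⟩
    rw [div_mul_eq_mul_div, one_mul, div_le_iff₀ (by positivity)] at hm
    rw [div_le_iff₀ hm']
    linarith
  refine (hpar F μ h δ hδ m (by exact_mod_cast hm') hε P R hind hlaw).trans
    (measureReal_mono fun ω hω => ?_)
  obtain ⟨hμ, hσ'⟩ := hω
  have hval := hK F μ h N hN
  have hsq : √(Real.log N * Real.log (1 / δ) / m)
      = √(Real.log N) * √(Real.log (1 / δ) / m) := by
    rw [mul_div_assoc, Real.sqrt_mul (Real.log_nonneg (by exact_mod_cast hN))]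
  rw [Set.mem_ofPred_eq, hsq]
  set ε := √(Real.log (1 / δ) / m)
  have hε0 : 0 ≤ ε := Real.sqrt_nonneg _
  set l := √(Real.log N)
  have hl0 : 0 ≤ l := Real.sqrt_nonneg _
  set E := TailMoM.value (gaussianReal 0 1) N
  have hE0 : 0 ≤ E := TailMoM.value_gaussian_nonneg hN
  have hE : E ≤ √2 * l := TailMoM.value_gaussian_le hN
  set D : Fin m → ℝ := fun i => R i ω
  have hsplit : TailMoM.valueHat α N D - TailMoM.value F N = (TailMoM.muHat α D - μ)
      + (TailMoM.sigmaHat α D - σ) * E + (μ + σ * E - TailMoM.value F N) := by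
    rw [TailMoM.valueHat]; ring
  have hp : 0 ≤ (1 - α / 2) ^ N := by positivity
  -- the error of the location estimate carries no factor `√(log N)`: it is absorbed by the
  -- first term when `2 ≤ N`, and by the second term when `N = 1`
  have hloc : κ * ε ≤ κ / √(Real.log 2) * (l * ε) + κ * ε₀ / (1 - α / 2) * (1 - α / 2) ^ N := by
    rcases hN.eq_or_lt with rfl | hN2
    · have : κ * ε₀ / (1 - α / 2) * (1 - α / 2) ^ 1 = κ * ε₀ := by
        rw [pow_one, div_mul_cancel₀ _ hβ.ne']
      rw [this]
      have h1 : 0 ≤ κ / √(Real.log 2) * (l * ε) := by positivity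
      have h2 : κ * ε ≤ κ * ε₀ := by gcongr
      linarith
    · have h1 : √(Real.log 2) ≤ l := by
        apply Real.sqrt_le_sqrt
        apply Real.log_le_log two_pos
        exact_mod_cast hN2
      have h2 : 0 ≤ κ * ε₀ / (1 - α / 2) * (1 - α / 2) ^ N := by positivity
      have h3 : κ * ε = κ / √(Real.log 2) * (√(Real.log 2) * ε) := by field_simp
      have h4 : κ / √(Real.log 2) * (√(Real.log 2) * ε) ≤ κ / √(Real.log 2) * (l * ε) := by
        gcongr
      linarith
  have hscale : |(TailMoM.sigmaHat α D - σ) * E| ≤ κ * √2 * (l * ε) := by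
    rw [abs_mul, abs_of_nonneg hE0]
    calc _ ≤ κ * ε * (√2 * l) := by gcongr
      _ = _ := by ring
  have hKp : K * (1 - α / 2) ^ N ≤ |K| * (1 - α / 2) ^ N := by gcongr; exact le_abs_self K
  rw [hsplit]
  have htri := abs_add_three (TailMoM.muHat α D - μ) ((TailMoM.sigmaHat α D - σ) * E)
    (μ + σ * E - TailMoM.value F N)
  have r1 : 0 ≤ (κ / √(Real.log 2) + κ * √2) * (1 - α / 2) ^ N := by positivity
  have r2 : 0 ≤ (κ * ε₀ / (1 - α / 2) + |K|) * (l * ε) := by positivity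
  linarith
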